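/- Let $\Sigma$ be a finite alphabet. A hyperproperty is a set $\mathbf S\subseteq\mathcal P(\Sigma^\omega)$. For $T\subseteq\Sigma^*$ and $T'\subseteq\Sigma^\omega$ write $T\le T'$ if every $t\in T$ is a prefix of some $t'\in T'$; $T$ is a bad prefix of $\mathbf S$ if $T'\notin\mathbf S$ for every $T'\ge T$. $\mathbf S$ is $k$-safety if every $T'\notin\mathbf S$ has a bad prefix $T\le T'$ with $|T|\le k$. For $k\ge 1$, a word $\sigma\in(\Sigma^k)^*$ represents the set $\mathrm{unzip}(\sigma)$ of its $k$ component traces. A language $L\subseteq(\Sigma^k)^*$ is a $k$-representation of $\mathbf S$ if all its words represent bad prefixes of $\mathbf S$ and, for all $T'\subseteq\Sigma^\omega$, $T'\notin\mathbf S$ iff $\mathrm{unzip}(\sigma)\le T'$ for some $\sigma\in L$. A finite automaton recognizing a $k$-representation of $\mathbf S$ is a $k$-bad-prefix automaton for $\mathbf S$, and $\mathbf S$ is regular if it has one for some $k\ge1$. A $k$-bad-prefix automaton is tight if it accepts a representation of every bad prefix that consists of at most $k$ traces of a common length; it is permutation-complete if, with a word $\sigma$, it accepts all words $\sigma'\in(\Sigma^k)^*$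 with $\mathrm{unzip}(\sigma')=\mathrm{unzip}(\sigma)$. A deterministic, tight, permutation-complete $k$-bad-prefix automaton for $\mathbf S$ is minimal if $\mathbf S$ has no bad-prefix automaton of arity less than $k$, and no deterministic (complete), tight, permutation-complete $k$-bad-prefix automaton for $\mathbf S$ has fewer states. A teacher for $\mathbf S$ answers membership queries (does $\sigma\in(\Sigma^{k'})^*$ represent a bad prefix of $\mathbf S$?) and equivalence queries (is the deterministic automaton $\mathcal A$ over $\Sigma^{k'}$ a $k'$-bad-prefix automaton for $\mathbf S$?). If the answer to an equivalence query is no, it provides a counterexample: a representation, of some arity $c$, of a bad prefix of which $\mathcal A$ accepts no representation, or a word accepted by $\mathcal A$ (then $c=k'$) that does not represent a bad prefix. Let $\kappa$ be the least arity of a bad-prefix automaton for $\mathbf S$. The teacher is minimal-adequate if its answers are correct and, for queried automata of arity at most $\kappa$, its counterexamples have arity at most $\kappa$ and are of minimal length among the counterexamples of arity at most $\kappa$. The algorithm $L^*_{Hyper}$ keeps an observation table over $\Sigma^{k'}$, with accessing sequences $S$, separating sequences $E$ and the membership answers for $(S\cup S\cdot\Sigma^{k'})\cdot E$; it starts with $k'=1$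 and $S=E=\{\varepsilon\}$. As in Angluin's $L^*$ it repairs the table until it is consistent and closed, and then makes an equivalence query with the automaton whose states are the rows of $S$. A counterexample of arity $c\le k'$ is extended to arity $k'$ by repeating its last component, and its prefixes are added to $S$. If $c>k'$, the words of $S$ and $E$ are first extended to arity $c$ in the same way, the table is filled again, and the learner continues with arity $c$. If the answer is yes, then for every $\varsigma:\{1,\dots,k'\}\to\{1,\dots,k'\}$ the algorithm searches, by breadth-first search in a product automaton, for a word that is rejected although the word obtained from it by permuting all its letters by $\varsigma$ is accepted. Such a word is treated as a further counterexample; if there is none, the algorithm stops and returns the automaton. Its running time is the number of elementary operations on letters, bits, states, list cells and array cells, including the writing of queries and the reading of answers, but not the work of the teacher. **Theorem.** For every finite alphabet $\Sigma$ there is a constant $C$ such that the following holds for every $k_0\ge1$, every regular $k_0$-safety hyperproperty $\mathbf S$ over $\Sigma$ and every minimal-adequate teacher for $\mathbf S$. $L^*_{Hyper}$ terminates and returns a minimal, deterministic, tight and permutation-complete bad-prefix automaton $\mathcal A$ for $\mathbf S$. Its arity $k$ satisfies $k\le k_0$, and the running time is at most $$C\,(n+m)^{C}\,(k+1)^{C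 k},$$ where $n$ is the number of states of $\mathcal A$ and $m$ is the length of the longest counterexample provided by the teacher ($0$ if there is none). So the running time is polynomial in $n$ and $m$ and exponential, $2^{O(k\log k)}$, in $k$. -/

import Mathlib

namespace HyperLearn

/-! ### Hyperproperties, bad prefixes and representations -/

/-- A hyperproperty over the alphabet `A`: a set of sets of infinite traces. -/
abbrev Hyperproperty (A : Type) := Set (Set (ℕ → A))

/-- The finite trace `t` is a prefix of the infinite trace `t'`. -/
def TracePrefix {A : Type} (t : List A) (t' : ℕ → A) : Prop :=
  ∀ (i : ℕ) (h : i < t.length), t[i] = t' i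

/-- `T ≤ T'`: every finite trace of `T` is a prefix of some infinite trace of `T'`. -/
def SetPrefix {A : Type} (T : Set (List A)) (T' : Set (ℕ → A)) : Prop :=
  ∀ t ∈ T, ∃ t' ∈ T', TracePrefix t t'

/-- The bad prefixes of `S`. -/
def bad {A : Type} (S : Hyperproperty A) : Set (Set (List A)) :=
  {T | ∀ T' : Set (ℕ → A), SetPrefix T T' → T' ∉ S}

/-- `S` is a `k`-safety hyperproperty: every violating set of traces has a bad prefix with at
most `k` elements. -/
def IsKSafety {A : Type} (S : Hyperproperty A) (k : ℕ) : Prop :=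
  ∀ T' : Set (ℕ → A), T' ∉ S → ∃ T ∈ bad S, T.encard ≤ k ∧ SetPrefix T T'

/-- Words over the alphabet `A ^ k`. Arities are positive. -/
abbrev Word (A : Type) (k : ℕ+) := List (Fin k → A)

/-- The set of the `k` finite traces of a word over `A ^ k`. -/
def unzip {A : Type} {k : ℕ+} (w : Word A k) : Set (List A) :=
  Set.range fun i : Fin k => w.map fun v => v i

/-- `L` is a `k`-representation of `S`: its words represent bad prefixes only, and the violating
sets of traces are exactly those with a bad prefix represented in `L`. -/
def IsRepresentation {A : Type} {k : ℕ+} (S : Hyperproperty A) (L : Language (Fin k → A)) : Prop :=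
  (∀ w ∈ L, unzip w ∈ bad S) ∧
    ∀ T' : Set (ℕ → A), T' ∉ S ↔ ∃ w ∈ L, SetPrefix (unzip w) T' ∧ unzip w ∈ bad S

/-- There is a `k`-bad-prefix automaton for `S`, i.e. a finite automaton recognizing a
`k`-representation of `S`. -/
def HasBadPrefixAutomaton {A : Type} (S : Hyperproperty A) (k : ℕ+) : Prop :=
  ∃ L : Language (Fin k → A), L.IsRegular ∧ IsRepresentation S L

/-- `S` is regular: one of its representations is a regular language. -/
def IsRegularHyper {A : Type} (S : Hyperproperty A) : Prop :=
  ∃ k : ℕ+, HasBadPrefixAutomaton S k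

/-- `k` is the minimal arity of a bad-prefix automaton for `S`. -/
def IsTargetArity {A : Type} (S : Hyperproperty A) (k : ℕ+) : Prop :=
  HasBadPrefixAutomaton S k ∧ ∀ k' < k, ¬ HasBadPrefixAutomaton S k'

/-- Tightness: a representation of every bad prefix with at most `k` traces is accepted. Only
sets of traces of a common length have representations. -/
def IsTight {A : Type} {k : ℕ+} (S : Hyperproperty A) (L : Language (Fin k → A)) : Prop :=
  ∀ T ∈ bad S, T.encard ≤ (k : ℕ) → (∃ l : ℕ, ∀ t ∈ T, t.length = l) → ∃ w ∈ L, unzip w = T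

/-- Permutation-completeness: with one representation of a set of traces, all of its
representations of the same arity are accepted. -/
def IsPermComplete {A : Type} {k : ℕ+} (L : Language (Fin k → A)) : Prop :=
  ∀ w ∈ L, ∀ w' : Word A k, unzip w' = unzip w → w' ∈ L

/-- The deterministic automaton `M` is a tight and permutation-complete `k`-bad-prefix automaton
for `S`. -/
structure IsTightPermCompleteBPA {A : Type} {k : ℕ+} {n : ℕ} (S : Hyperproperty A)
    (M : DFA (Fin k → A) (Fin n)) : Prop where
  representation : IsRepresentation S M.accepts
  tight : IsTight S M.accepts
  permComplete : IsPermComplete M.accepts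

/-- `M` is moreover minimal: no bad-prefix automaton for `S` has a smaller arity, and no
deterministic, tight, permutation-complete one of the same arity has fewer states. -/
structure IsMinimalBPA {A : Type} {k : ℕ+} {n : ℕ} (S : Hyperproperty A)
    (M : DFA (Fin k → A) (Fin n)) : Prop extends IsTightPermCompleteBPA S M where
  arity_minimal : ∀ k' < k, ¬ HasBadPrefixAutomaton S k'
  size_minimal : ∀ (n' : ℕ) (M' : DFA (Fin k → A) (Fin n')), IsTightPermCompleteBPA S M' → n ≤ n'

/-! ### Teachers -/

/-- A teacher answers membership queries (words of any arity) and equivalence queries (deterministic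
automata of any arity). The answer `none` to an equivalence query means "yes"; otherwise a
counterexample is given by a representation, together with its arity. -/
structure Teacher (A : Type) where
  member : (k : ℕ+) → Word A k → Bool
  equiv : (k : ℕ+) → (n : ℕ) → DFA (Fin k → A) (Fin n) → Option ((c : ℕ+) × Word A c)

/-- The counterexamples to the conjecture that `M` is a bad-prefix automaton for `S`: a bad prefix,
given by a representation `w` of arity `c`, of which `M` accepts no representation, or
an accepted word that does not represent a bad prefix. -/
inductive IsCounterexample {A : Type} (S : Hyperproperty A) {k : ℕ+} {n : ℕ}
    (M : DFA (Fin k → A) (Fin n)) : (c : ℕ+) → Word A c → Prop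
  | missed {c : ℕ+} (w : Word A c) (hw : unzip w ∈ bad S)
      (h : ∀ v : Word A k, unzip v = unzip w → v ∉ M.accepts) : IsCounterexample S M c w
  | spurious (w : Word A k) (hw : w ∈ M.accepts) (h : unzip w ∉ bad S) : IsCounterexample S M k w

/-- The teacher is minimal-adequate for `S`. All its membership answers are right, and, for every
queried automaton `M` whose arity does not exceed the target arity `κ`, it says "yes" exactly if `M`
is a bad-prefix automaton for `S`, and otherwise returns a counterexample of arity at most `κ` that
is shortest among the counterexamples of arity at most `κ`. -/
structure MinimalAdequate {A : Type} (S : Hyperproperty A) (T : Teacher A) : Prop where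
  member_iff : ∀ (k : ℕ+) (w : Word A k), T.member k w = true ↔ unzip w ∈ bad S
  equiv_none_iff : ∀ κ, IsTargetArity S κ → ∀ (k : ℕ+) (n : ℕ) (M : DFA (Fin k → A) (Fin n)),
    k ≤ κ → (T.equiv k n M = none ↔ IsRepresentation S M.accepts)
  equiv_some : ∀ κ, IsTargetArity S κ → ∀ (k : ℕ+) (n : ℕ) (M : DFA (Fin k → A) (Fin n)),
    k ≤ κ → ∀ (c : ℕ+) (w : Word A c), T.equiv k n M = some ⟨c, w⟩ →
      IsCounterexample S M c w ∧ c ≤ κ ∧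
        ∀ (c' : ℕ+) (w' : Word A c'), c' ≤ κ → IsCounterexample S M c' w' → w.length ≤ w'.length

/-! ### Computations with a step count

The unit of time is an elementary operation on a letter of `A`, a bit, a state, a list cell or an
array cell. A letter of `A ^ k` is an array of `k` letters, so that copying, comparing or
addressing with it takes time `k`. -/

/-- A computation: its result and the number of elementary steps it takes. -/
structure Timed (α : Type) where
  val : α
  time : ℕ

namespace Timed

instance : Monad Timed where
  pure a := ⟨a, 0⟩
  bind x f := ⟨(f x.val).val, x.time + (f x.val).time⟩

/-- Spend `n` steps. -/
def tick (n : ℕ) : Timed Unit := ⟨(), n⟩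

/-- Apply `f` to all elements of a list. -/
def map {α β : Type} (f : α → Timed β) : List α → Timed (List β)
  | [] => do
      tick 1
      return []
  | x :: xs => do
      tick 1
      let y ← f x
      let ys ← map f xs
      return y :: ys

/-- The first success of `f` on a list. -/
def findSome {α β : Type} (f : α → Timed (Option β)) : List α → Timed (Option β)
  | [] => do
      tick 1
      return none
  | x :: xs => do
      tick 1
      match ← f x with
      | some y => return some y
      | none => findSome f xs

/-- Does some element of a list pass the test `f`? -/
def any {α : Type} (f : α → Timed Bool) : List α → Timed Bool
  | [] => do
      tick 1
      return false
  | x :: xs => do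
      tick 1
      match ← f x with
      | true => return true
      | false => any f xs

/-- Run through a list, updating an accumulator. -/
def fold {α β : Type} (f : β → α → Timed β) : β → List α → Timed β
  | b, [] => do
      tick 1
      return b
  | b, x :: xs => do
      tick 1
      let b' ← f b x
      fold f b' xs

/-- Add an element at the end of a list. -/
def snoc {α : Type} (l : List α) (x : α) : Timed (List α) := do
  tick (l.length + 1)
  return l ++ [x]

/-- Fill an array indexed by a finite type, cell by cell. -/
def tabulate {ι β : Type} [Fintype ι] (f : ι → Timed β) : Timed (ι → β) :=
  ⟨fun i => (f i).val, ∑ i, ((f i).time + 1)⟩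

/-- List all `k`-tuples of elements of a list. -/
def tuples {β : Type} (l : List β) : (k : ℕ) → Timed (List (Fin k → β))
  | 0 => do
      tick 1
      return [Fin.elim0]
  | k + 1 => do
      let vs ← tuples l k
      fold (fun acc b =>
        fold (fun acc' (v : Fin k → β) => do
          tick (k + 1)
          return (Fin.cons b v : Fin (k + 1) → β) :: acc') acc vs) [] l

end Timed

open Timed

/-! ### The learner -/

section Learner

variable {A : Type} [Fintype A] [DecidableEq A]

/-- All letters of `A ^ k`. -/
noncomputable def letters (A : Type) [Fintype A] (k : ℕ+) : Timed (List (Fin k → A)) :=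
  tuples (Finset.univ : Finset A).toList k

/-- Comparison of two rows of bits. -/
def eqRow (r r' : List Bool) : Timed Bool := do
  tick (r.length + r'.length + 1)
  return decide (r = r')

/-- Comparison of two words. -/
def eqWord {k : ℕ+} (w w' : Word A k) : Timed Bool := do
  tick (k * (w.length + w'.length) + 1)
  return decide (w = w')

/-- Concatenation of two words. -/
def concat {k : ℕ+} (w w' : Word A k) : Timed (Word A k) := do
  tick (k * (w.length + w'.length) + 1)
  return w ++ w'

/-- Extension of a `c`-tuple to a `k`-tuple, for `c ≤ k`, by repeating its last component. -/
def extendLetter {c : ℕ+} (k : ℕ+) (v : Fin c → A) : Fin k → A :=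
  fun i => v ⟨min i (c - 1), by have := c.pos; omega⟩

/-- Extension of a word to arity `k`. -/
def extend {c : ℕ+} (k : ℕ+) (w : Word A c) : Timed (Word A k) := do
  tick (k * w.length + 1)
  return w.map (extendLetter k)

/-- A membership query; the time is that of writing it down. -/
def ask (T : Teacher A) {k : ℕ+} (w : Word A k) : Timed Bool := do
  tick (k * w.length + 1)
  return T.member k w

/-- The line of an observation table that belongs to an accessing sequence `word`: the row of `word`
and the rows of all words `word · a`, with `a` a letter. -/
structure Entry (A : Type) (k : ℕ+) where
  word : Word A k
  row : List Bool
  succ : List ((Fin k → A) × List Bool)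

/-- An observation table over `A ^ k`: the separating sequences `E`, the empty word first, and one
entry for each accessing sequence. A row lists the answers for the words of `E`, in their order. -/
structure Table (A : Type) (k : ℕ+) where
  E : List (Word A k)
  entries : List (Entry A k)

/-- The row of a word: a membership query for each of its continuations by a word of `E`. -/
def askRow (T : Teacher A) {k : ℕ+} (E : List (Word A k)) (w : Word A k) : Timed (List Bool) :=
  Timed.map (fun e => do
    let we ← concat w e
    ask T we) E

/-- The observation table with accessing sequences `S` and separating sequences `E`, filled with
membership queries. -/
noncomputable def fill (T : Teacher A) {k : ℕ+} (S E : List (Word A k)) : Timed (Table A k) := do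
  let as ← letters A k
  let entries ← Timed.map (fun s => do
    let r ← askRow T E s
    let succ ← Timed.map (fun a => do
      let sa ← concat s [a]
      let r' ← askRow T E sa
      return (a, r')) as
    return (⟨s, r, succ⟩ : Entry A k)) S
  return ⟨E, entries⟩

/-- The accessing sequences of a table. -/
def accessing {k : ℕ+} (O : Table A k) : Timed (List (Word A k)) :=
  Timed.map (fun x => do
    tick 1
    return x.word) O.entries

/-- Consistency check. If two accessing sequences `s`, `t` have equal rows, but `s · a · e` and
`t · a · e` get different answers for a letter `a` and some `e` in `E`, then `a · e` is returned. -/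
def inconsistency {k : ℕ+} (O : Table A k) : Timed (Option (Word A k)) :=
  findSome (fun x => findSome (fun y => do
    match ← eqRow x.row y.row with
    | false => return none
    | true =>
      findSome (fun p => do
        findSome (fun q => do
          match q.2.1 == q.2.2 with
          | true => return none
          | false =>
            let ae ← concat [p.1.1] q.1
            return some ae)
          (O.E.zip (p.1.2.zip p.2.2)))
        (x.succ.zip y.succ)) O.entries) O.entries

/-- Closedness check. A word `s · a` whose row is not the row of any accessing sequence is
returned, if there is one. -/
def unclosed {k : ℕ+} (O : Table A k) : Timed (Option (Word A k)) :=
  findSome (fun x => findSome (fun p => do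
    match ← Timed.any (fun y => eqRow p.2 y.row) O.entries with
    | true => return none
    | false =>
      let sa ← concat x.word [p.1]
      return some sa) x.succ) O.entries

/-- A deterministic automaton over `A ^ k` with states `0, …, last`, stored in arrays. -/
structure Conjecture (A : Type) (k : ℕ+) where
  last : ℕ
  step : Fin (last + 1) → (Fin k → A) → Fin (last + 1)
  start : Fin (last + 1)
  accept : Fin (last + 1) → Bool

/-- The number of states. -/
abbrev Conjecture.size {k : ℕ+} (M : Conjecture A k) : ℕ := M.last + 1

/-- A conjecture as an automaton. -/
def Conjecture.toDFA {k : ℕ+} (M : Conjecture A k) : DFA (Fin k → A) (Fin M.size) where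
  step := M.step
  start := M.start
  accept := {q | M.accept q = true}

/-- The automaton of a closed and consistent table. Its states are the different rows of accessing
sequences, the row of the empty word being state `0`; a state is accepting if its first bit, which
belongs to the empty word, is `1`; and there is a transition with `a` from the row of `s` to the row
of `s · a`. -/
def conjecture {k : ℕ+} (O : Table A k) : Timed (Conjecture A k) := do
  let x₀ ← findSome (fun x => do
    match x.word with
    | [] => return some x
    | _ :: _ => return none) O.entries
  let x₀ : Entry A k := x₀.getD ⟨[], [], []⟩
  let others ← fold (fun xs x => do
    match ← Timed.any (fun y => eqRow x.row y.row) (x₀ :: xs) with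
    | true => return xs
    | false => snoc xs x) [] O.entries
  -- the states are put into an array
  tick (others.length + 1)
  let state : Fin (others.length + 1) → Entry A k := (x₀ :: others).get
  let step ← tabulate fun i => tabulate fun a : Fin k → A => do
    let r ← findSome (fun p => do
      tick (2 * k)
      return if p.1 = a then some p.2 else none) (state i).succ
    let j ← findSome (fun j => do
      match ← eqRow (r.getD []) (state j).row with
      | true => return some j
      | false => return none) (List.finRange (others.length + 1))
    tick k
    return j.getD 0
  let accept ← tabulate fun i => do
    tick 1
    return (state i).row.headD false
  return ⟨others.length, step, 0, accept⟩

/-- One round of the breadth-first search in the product of `M`, reading permuted letters,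
with `M`. The list `vis` holds the pairs of states reached so far, each with a word leading to it. -/
def searchRound {k : ℕ+} (M : Conjecture A k) (f : Fin k → Fin k) (as : List (Fin k → A))
    (vis : List (Word A k × Fin M.size × Fin M.size)) :
    Timed (List (Word A k × Fin M.size × Fin M.size)) :=
  fold (fun acc x => fold (fun acc' (a : Fin k → A) => do
    tick (4 * k)
    let p := M.step x.2.1 (fun i => a (f i))
    let q := M.step x.2.2 a
    match ← Timed.any (fun y => do
        tick 2
        return decide (y.2 = (p, q))) acc' with
    | true => return acc'
    | false =>
      let w ← concat x.1 [a]
      snoc acc' (w, p, q)) acc as) vis vis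

/-- A given number of rounds of the search. -/
def search {k : ℕ+} (M : Conjecture A k) (f : Fin k → Fin k) (as : List (Fin k → A)) :
    ℕ → List (Word A k × Fin M.size × Fin M.size) →
      Timed (List (Word A k × Fin M.size × Fin M.size))
  | 0, vis => do
      tick 1
      return vis
  | r + 1, vis => do
      tick 1
      let vis' ← searchRound M f as vis
      search M f as r vis'

/-- Check of permutation-completeness. For every function `f` from positions to positions, search
for a word that is not accepted by `M` although `M` accepts the word with letters permuted by `f`. -/
noncomputable def incompleteness {k : ℕ+} (M : Conjecture A k) : Timed (Option (Word A k)) := do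
  let as ← letters A k
  let fs ← tuples (List.finRange k) k
  findSome (fun f => do
    let vis ← search M f as (M.size * M.size) [([], M.start, M.start)]
    findSome (fun x => do
      tick 2
      return if M.accept x.2.1 = true ∧ M.accept x.2.2 = false then some x.1 else none) vis) fs

/-- Amend a table with a word: all its prefixes become accessing sequences. -/
noncomputable def amend (T : Teacher A) {k : ℕ+} (O : Table A k) (w : Word A k) :
    Timed (Table A k) := do
  let S ← accessing O
  tick ((w.length + 1) * (k * w.length + 1))
  let S' ← fold (fun S v => do
    match ← Timed.any (fun s => eqWord s v) S with
    | true => return S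
    | false => snoc S v) S w.inits
  fill T S' O.E

/-- Extend a table to a larger arity. -/
noncomputable def extendTable (T : Teacher A) {k : ℕ+} (c : ℕ+) (O : Table A k) :
    Timed (Table A c) := do
  let S ← accessing O
  let S' ← Timed.map (extend c) S
  let E' ← Timed.map (extend c) O.E
  fill T S' E'

/-- What one iteration of the learner leads to: a table over some arity `k` with which to go on,
together with the length of the counterexample that the teacher provided in this iteration (`0` if
there was none), or the final automaton. -/
inductive Outcome (A : Type) where
  | next (k : ℕ+) (O : Table A k) (cex : ℕ)
  | done (k : ℕ+) (M : Conjecture A k)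

/-- One iteration of the learner. -/
noncomputable def iteration (T : Teacher A) {k : ℕ+} (O : Table A k) : Timed (Outcome A) := do
  match ← inconsistency O with
  | some e =>
    let S ← accessing O
    let E ← snoc O.E e
    let O' ← fill T S E
    return .next k O' 0
  | none =>
  match ← unclosed O with
  | some s =>
    let S ← accessing O
    let S' ← snoc S s
    let O' ← fill T S' O.E
    return .next k O' 0
  | none =>
  let M ← conjecture O
  -- the time of writing down the equivalence query
  tick (M.size * Fintype.card A ^ (k : ℕ) * (k + 1) + M.size + 1)
  match T.equiv k M.size M.toDFA with
  | some ⟨c, w⟩ =>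
    -- the time of reading the counterexample
    tick (c * w.length + 1)
    if c ≤ k then
      let w' ← extend k w
      let O' ← amend T O w'
      return .next k O' w.length
    else
      let O₁ ← extendTable T c O
      let O₂ ← amend T O₁ w
      return .next c O₂ w.length
  | none =>
    match ← incompleteness M with
    | some w =>
      let O' ← amend T O w
      return .next k O' 0
    | none => return .done k M

/-- Started with the table `O`, the learner stops with the automaton `M`, after time `t`, and the
longest counterexample provided by the teacher meanwhile has length `m` (`0` if there was none). -/
inductive Runs (T : Teacher A) {k' : ℕ+} (M : Conjecture A k') :
    {k : ℕ+} → Table A k → (t m : ℕ) → Prop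
  | done {k : ℕ+} (O : Table A k) (h : (iteration T O).val = .done k' M) :
      Runs T M O (iteration T O).time 0
  | next {k : ℕ+} (O : Table A k) {c : ℕ+} (O' : Table A c) (l t m : ℕ)
      (h : (iteration T O).val = .next c O' l) (h' : Runs T M O' t m) :
      Runs T M O ((iteration T O).time + t) (max l m)

/-- The learning algorithm, started over arity `1` with the empty word as the only accessing
and separating sequence, stops with the automaton `M`, after time `t`, and the longest
counterexample provided by the teacher has length `m`. -/
def Learns (T : Teacher A) {k : ℕ+} (M : Conjecture A k) (t m : ℕ) : Prop :=
  ∃ t' : ℕ, t = (fill T (k := 1) [[]] [[]]).time + t' ∧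
    Runs T M (fill T (k := 1) [[]] [[]]).val t' m

end Learner

end HyperLearn

open HyperLearn

/-!
Let `κ` be the least arity of a bad-prefix automaton for the hyperproperty, and let `N` be the
number of states of a minimal automaton for the language of all words of arity `κ` that represent
bad prefixes; it is the only tight and permutation-complete representation of arity `κ`. Repeating
the last component turns a word of arity at most `κ` into one of arity `κ` with the same
components, so no table of arity at most `κ` has more than `N` different rows. Counterexamples have
arity at most `κ`, so no larger arity occurs. An iteration that does not stop raises the arity, adds
a new row, or makes a consistent table inconsistent, which bounds the number of iterations.

The states of a conjecture are rows of accessing sequences, accepting if the sequence represents a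
bad prefix. As bad prefixes can be told from their infinite continuations, accepting states lead
only to accepting states and a rejecting state has a rejecting successor. If a conjecture is a
representation and closed under permutations, but rejects a word that represents a bad prefix,
then an infinite continuation of this word is rejected forever. The set of its components violates
the hyperproperty, so some accepted word represents a bad prefix of it, and this word is a
permutation of a prefix of the continuation: a contradiction. So the learner stops only with an
automaton for the language of all words that represent bad prefixes.

Every part of an iteration costs a fixed power of a number that bounds the size of the table, the
number `|A| ^ κ` of letters and the number `κ ^ κ` of maps of the components.
-/

namespace HyperLearn

open Timed

/-! ### Timed computations -/

namespace Timed

variable {α β : Type}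

@[simp] theorem pure_val (a : α) : (pure a : Timed α).val = a := rfl

@[simp] theorem pure_time (a : α) : (pure a : Timed α).time = 0 := rfl

@[simp] theorem bind_val (x : Timed α) (f : α → Timed β) : (x >>= f).val = (f x.val).val := rfl

@[simp] theorem bind_time (x : Timed α) (f : α → Timed β) :
    (x >>= f).time = x.time + (f x.val).time := rfl

@[simp] theorem tick_time (n : ℕ) : (tick n).time = n := rfl

@[simp] theorem snoc_val (l : List α) (x : α) : (snoc l x).val = l ++ [x] := rfl

@[simp] theorem snoc_time (l : List α) (x : α) : (snoc l x).time = l.length + 1 := rfl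

@[simp] theorem map_val (f : α → Timed β) (l : List α) :
    (Timed.map f l).val = l.map fun x => (f x).val := by
  induction l with
  | nil => rfl
  | cons x xs ih => simp [Timed.map, ih]

@[simp] theorem findSome_val (f : α → Timed (Option β)) (l : List α) :
    (findSome f l).val = l.findSome? fun x => (f x).val := by
  induction l with
  | nil => rfl
  | cons x xs ih =>
    rw [findSome, List.findSome?_cons]
    simp only [bind_val]
    cases (f x).val <;> simp [ih]

@[simp] theorem any_val (f : α → Timed Bool) (l : List α) :
    (Timed.any f l).val = l.any fun x => (f x).val := by
  induction l with
  | nil => rfl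
  | cons x xs ih =>
    rw [Timed.any, List.any_cons]
    simp only [bind_val]
    cases (f x).val <;> simp [ih]

@[simp] theorem fold_val (f : β → α → Timed β) (b : β) (l : List α) :
    (fold f b l).val = l.foldl (fun b x => (f b x).val) b := by
  induction l generalizing b with
  | nil => rfl
  | cons x xs ih => simp [fold, ih]

theorem map_time_le {f : α → Timed β} {l : List α} {c : ℕ} (h : ∀ x ∈ l, (f x).time ≤ c) :
    (Timed.map f l).time ≤ l.length * (c + 1) + 1 := by
  induction l with
  | nil => simp [Timed.map]
  | cons x xs ih =>
    have hx := h x (by simp)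
    have hxs := ih fun y hy => h y (by simp [hy])
    simp only [Timed.map, bind_time, tick_time, pure_time, List.length_cons]
    linarith

theorem findSome_time_le {f : α → Timed (Option β)} {l : List α} {c : ℕ}
    (h : ∀ x ∈ l, (f x).time ≤ c) : (findSome f l).time ≤ l.length * (c + 1) + 1 := by
  induction l with
  | nil => simp [findSome]
  | cons x xs ih =>
    have hx := h x (by simp)
    have hxs := ih fun y hy => h y (by simp [hy])
    simp only [findSome, bind_time, tick_time, List.length_cons]
    cases (f x).val <;> simp only [pure_time] <;> linarith

theorem any_time_le {f : α → Timed Bool} {l : List α} {c : ℕ} (h : ∀ x ∈ l, (f x).time ≤ c) :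
    (Timed.any f l).time ≤ l.length * (c + 1) + 1 := by
  induction l with
  | nil => simp [Timed.any]
  | cons x xs ih =>
    have hx := h x (by simp)
    have hxs := ih fun y hy => h y (by simp [hy])
    simp only [Timed.any, bind_time, tick_time, List.length_cons]
    cases (f x).val <;> simp only [pure_time] <;> linarith

theorem tabulate_time_le {ι : Type} [Fintype ι] {f : ι → Timed β} {c : ℕ}
    (h : ∀ i, (f i).time ≤ c) : (tabulate f).time ≤ Fintype.card ι * (c + 1) := by
  simpa only [tabulate, smul_eq_mul, Finset.card_univ] using
    Finset.sum_le_card_nsmul Finset.univ _ (c + 1) fun i _ => Nat.succ_le_succ (h i)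

theorem fold_invariant {f : β → α → Timed β} {c : ℕ} (P : ℕ → β → Prop) {l : List α}
    (h : ∀ i b, ∀ x ∈ l, i < l.length → P i b → P (i + 1) (f b x).val ∧ (f b x).time ≤ c)
    {b : β} (hb : P 0 b) :
    P l.length (fold f b l).val ∧ (fold f b l).time ≤ l.length * (c + 1) + 1 := by
  induction l generalizing b P with
  | nil => simpa [fold] using hb
  | cons x xs ih =>
    obtain ⟨hval, htime⟩ := h 0 b x (by simp) (by simp) hb
    obtain ⟨hval', htime'⟩ := ih (fun i => P (i + 1))
      (fun i b y hy hi hP => h (i + 1) b y (by simp [hy]) (by simpa using hi) hP) hval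
    refine ⟨by simpa [fold] using hval', ?_⟩
    simp only [fold, bind_time, tick_time, List.length_cons]
    linarith

theorem fold_time_le {f : β → α → Timed β} {l : List α} {c : ℕ}
    (h : ∀ b, ∀ x ∈ l, (f b x).time ≤ c) (b : β) :
    (fold f b l).time ≤ l.length * (c + 1) + 1 :=
  (fold_invariant (fun _ _ => True) (fun _ b x hx _ _ => ⟨trivial, h b x hx⟩) trivial).2

theorem tuples_succ_val (l : List β) (k : ℕ) : (tuples l (k + 1)).val =
    (l.map fun b => ((tuples l k).val.map (Fin.cons b : _ → Fin (k + 1) → β)).reverse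
      ).reverse.flatten := by
  simp [tuples]

theorem mem_tuples {l : List β} {k : ℕ} {v : Fin k → β} (h : ∀ i, v i ∈ l) :
    v ∈ (tuples l k).val := by
  induction k with
  | zero => simp [tuples, Subsingleton.elim v Fin.elim0]
  | succ k ih =>
    have htail : Fin.tail v ∈ (tuples l k).val := ih fun i => h i.succ
    simpa [tuples_succ_val] using ⟨v 0, h 0, Fin.tail v, htail, Fin.cons_self_tail v⟩

theorem length_tuples (l : List β) (k : ℕ) : (tuples l k).val.length = l.length ^ k := by
  induction k with
  | zero => simp [tuples]
  | succ k ih => simp [tuples_succ_val, List.length_flatten, Function.comp_def, ih, pow_succ']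

theorem tuples_time_le (l : List β) (k : ℕ) :
    (tuples l k).time ≤ (k + 2) ^ 2 * (l.length + 1) ^ k := by
  induction k with
  | zero => simp [tuples]
  | succ k ih =>
    set n := l.length
    have hinner : ∀ (acc : List (Fin (k + 1) → β)) (b : β),
        (fold (fun acc' (v : Fin k → β) => do
          tick (k + 1)
          return (Fin.cons b v : Fin (k + 1) → β) :: acc') acc (tuples l k).val).time ≤
          n ^ k * (k + 2) + 1 := fun acc b => by
      have := fold_time_le (l := (tuples l k).val) (c := k + 1)
        (f := fun acc' v => do
          tick (k + 1)
          return (Fin.cons b v : Fin (k + 1) → β) :: acc') (fun _ _ _ => by simp) acc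
      rwa [length_tuples] at this
    have houter : (tuples l (k + 1)).time ≤
        (tuples l k).time + (n * (n ^ k * (k + 2) + 1 + 1) + 1) :=
      Nat.add_le_add_left (fold_time_le (fun acc b _ => hinner acc b) []) _
    have hpow : n ^ k ≤ (n + 1) ^ k := Nat.pow_le_pow_left n.le_succ k
    have hone : 1 ≤ (n + 1) ^ k := Nat.one_le_pow _ _ n.succ_pos
    calc (tuples l (k + 1)).time
        ≤ (k + 2) ^ 2 * (n + 1) ^ k + (n * (n ^ k * (k + 2) + 1 + 1) + 1) := by omega
      _ ≤ (k + 2) ^ 2 * (n + 1) ^ k + (n * ((n + 1) ^ k * (k + 2) + 1 + 1) + 1) := by gcongr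
      _ ≤ (k + 1 + 2) ^ 2 * (n + 1) ^ (k + 1) := by
        rw [pow_succ (n + 1)]
        nlinarith [Nat.mul_le_mul_left n hone]

end Timed

/-! ### Bad prefixes -/

section BadPrefixes

open Stream'

section TracePrefix

variable {α β : Type}

theorem tracePrefix_iff_take_eq {t : List α} {τ : Stream' α} :
    TracePrefix t τ ↔ τ.take t.length = t := by
  constructor
  · intro h
    exact List.ext_getElem (by simp) fun i _ hi => by
      rw [take_get]; exact (h i hi).symm
  · intro h i hi
    have := List.getElem_of_eq h.symm hi
    rwa [take_get] at this

theorem tracePrefix_append (t : List α) (τ : Stream' α) : TracePrefix t (t ++ₛ τ) := by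
  rw [tracePrefix_iff_take_eq, take_append_of_le_length _ _ _ le_rfl, List.take_length]

theorem tracePrefix_iff_exists_append {t : List α} {τ : Stream' α} :
    TracePrefix t τ ↔ ∃ τ', t ++ₛ τ' = τ := by
  constructor
  · intro h
    refine ⟨τ.drop t.length, ?_⟩
    conv_lhs => rw [← tracePrefix_iff_take_eq.1 h, length_take]
    exact append_take_drop _ _
  · rintro ⟨τ', rfl⟩
    exact tracePrefix_append t τ'

theorem TracePrefix.of_prefix {t u : List α} {τ : ℕ → α} (hu : TracePrefix u τ) (h : t <+: u) :
    TracePrefix t τ := fun i hi => by rw [← hu i (hi.trans_le h.length_le), h.getElem]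

theorem TracePrefix.prefix_take {t : List α} {τ : Stream' α} (h : TracePrefix t τ) {n : ℕ}
    (hn : t.length ≤ n) : t <+: τ.take n := by
  rw [← tracePrefix_iff_take_eq.1 h]
  simpa using take_prefix_take_left _ _ τ hn

theorem tracePrefix_take (τ : Stream' α) (n : ℕ) : TracePrefix (τ.take n) τ :=
  tracePrefix_iff_take_eq.2 (by simp)

theorem SetPrefix.of_prefix {T U : Set (List α)} {T' : Set (ℕ → α)} (hU : SetPrefix U T')
    (h : ∀ t ∈ T, ∃ u ∈ U, t <+: u) : SetPrefix T T' := by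
  intro t ht
  obtain ⟨u, hu, htu⟩ := h t ht
  obtain ⟨t', ht', hut'⟩ := hU u hu
  exact ⟨t', ht', hut'.of_prefix htu⟩

theorem SetPrefix.mono_right {T : Set (List α)} {T' U' : Set (ℕ → α)} (hT : SetPrefix T T')
    (h : T' ⊆ U') : SetPrefix T U' := fun t ht =>
  let ⟨t', ht', hp⟩ := hT t ht
  ⟨t', h ht', hp⟩

end TracePrefix

section BadPrefixes

variable {A : Type} {S : Hyperproperty A} {k c : ℕ+}

/-- The word whose `i`th component is the component `f i` of `w`. -/
def permute {k c : ℕ} (f : Fin c → Fin k) (w : List (Fin k → A)) : List (Fin c → A) :=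
  w.map (· ∘ f)

/-- The set of the components of an infinite word over `A ^ k`. -/
def unzipω {k : ℕ} (τ : Stream' (Fin k → A)) : Set (ℕ → A) := Set.range fun i => τ.map (· i)

/-- The language of all words over `A ^ k` that represent bad prefixes of `S`. -/
def badWords (S : Hyperproperty A) (k : ℕ+) : Language (Fin k → A) := {w | unzip w ∈ bad S}

theorem mem_badWords {w : Word A k} : w ∈ badWords S k ↔ unzip w ∈ bad S := Iff.rfl

theorem mem_bad_of_prefix {T U : Set (List A)} (hT : T ∈ bad S)
    (h : ∀ t ∈ T, ∃ u ∈ U, t <+: u) : U ∈ bad S := fun T' hT' => hT T' (hT'.of_prefix h)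

theorem nonempty_of_mem_bad (h0 : ∅ ∈ S) {T : Set (List A)} (hT : T ∈ bad S) : T.Nonempty := by
  rw [Set.nonempty_iff_ne_empty]
  rintro rfl
  exact hT ∅ (fun t ht => ht.elim) h0

theorem mem_badWords_of_permute {f : Fin c → Fin k} {w : Word A k}
    (h : permute f w ∈ badWords S c) : w ∈ badWords S k := by
  refine mem_bad_of_prefix h ?_
  rintro _ ⟨i, rfl⟩
  exact ⟨_, ⟨f i, rfl⟩, by simp [permute, Function.comp_def]⟩

theorem append_mem_badWords {w : Word A k} (h : w ∈ badWords S k) (u : Word A k) :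
    w ++ u ∈ badWords S k := by
  refine mem_bad_of_prefix h ?_
  rintro _ ⟨i, rfl⟩
  exact ⟨_, ⟨i, rfl⟩, (List.prefix_append w u).map _⟩

theorem TracePrefix.setPrefix_unzip {w : Word A k} {τ : Stream' (Fin k → A)}
    (h : TracePrefix w τ) : SetPrefix (unzip w) (unzipω τ) := by
  rintro _ ⟨i, rfl⟩
  refine ⟨_, ⟨i, rfl⟩, ?_⟩
  rw [tracePrefix_iff_take_eq, ← map_take, List.length_map, tracePrefix_iff_take_eq.1 h]

theorem setPrefix_unzip_iff {w : Word A k} {T' : Set (ℕ → A)} :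
    SetPrefix (unzip w) T' ↔ ∃ τ : Stream' (Fin k → A), TracePrefix w τ ∧ unzipω τ ⊆ T' := by
  constructor
  · intro h
    choose t ht hp using fun i : Fin k => h _ ⟨i, rfl⟩
    refine ⟨fun n i => t i n, fun n hn => funext fun i => ?_, ?_⟩
    · exact (List.getElem_map _).symm.trans (hp i n (by simpa using hn))
    · rintro _ ⟨i, rfl⟩
      exact ht i
  · rintro ⟨τ, hτ, hsub⟩
    exact hτ.setPrefix_unzip.mono_right hsub

theorem setPrefix_unzip_unzipω_iff {w : Word A c} {τ : Stream' (Fin k → A)} :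
    SetPrefix (unzip w) (unzipω τ) ↔
      ∃ f : Fin c → Fin k, permute f (τ.take w.length) = w := by
  constructor
  · intro h
    choose _ ht hp using fun i : Fin c => h _ ⟨i, rfl⟩
    choose f hf using ht
    refine ⟨f, ?_⟩
    rw [permute, map_take, ← tracePrefix_iff_take_eq]
    refine fun n hn => funext fun i => ?_
    have := hp i n (by simpa using hn)
    rw [← hf i] at this
    exact (List.getElem_map _).symm.trans this
  · rintro ⟨f, hf⟩
    rw [permute, map_take, ← tracePrefix_iff_take_eq] at hf
    refine hf.setPrefix_unzip.mono_right ?_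
    rintro _ ⟨i, rfl⟩
    exact ⟨f i, rfl⟩

theorem exists_snoc_notMem_badWords {w : Word A k} (h : w ∉ badWords S k) :
    ∃ a, w ++ [a] ∉ badWords S k := by
  simp only [mem_badWords, bad, Set.mem_ofPred_eq, not_forall, not_not] at h
  obtain ⟨T', hT', hS⟩ := h
  obtain ⟨τ, hτ, hsub⟩ := setPrefix_unzip_iff.1 hT'
  refine ⟨τ.get w.length, fun hbad => hbad T' (setPrefix_unzip_iff.2 ⟨τ, ?_, hsub⟩) hS⟩
  have := tracePrefix_take τ (w.length + 1)
  rwa [take_succ', tracePrefix_iff_take_eq.1 hτ] at this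

theorem isRepresentation_badWords
    (h : ∀ T' ∉ S, ∃ w ∈ badWords S k, SetPrefix (unzip w) T') :
    IsRepresentation S (badWords S k) := by
  refine ⟨fun w hw => hw, fun T' => ⟨fun hT' => ?_, ?_⟩⟩
  · obtain ⟨w, hw, hwT'⟩ := h T' hT'
    exact ⟨w, hw, hwT', hw⟩
  · rintro ⟨w, hw, hwT', -⟩
    exact hw T' hwT'

theorem isPermComplete_badWords : IsPermComplete (badWords S k) := by
  intro w hw w' h
  rwa [mem_badWords, h]

theorem exists_range_eq_of_encard_le {α : Type*} {T : Set α} {n : ℕ} (hT : T.Nonempty)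
    (h : T.encard ≤ n) : ∃ g : Fin n → α, Set.range g = T := by
  have := hT.to_subtype
  have := (Set.finite_of_encard_le_coe h).fintype
  have hcard : Fintype.card T ≤ Fintype.card (Fin n) := by
    rw [Set.encard_eq_coe_toFinset_card, Set.toFinset_card] at h
    rw [Fintype.card_fin]
    exact_mod_cast h
  obtain ⟨e⟩ := Function.Embedding.nonempty_of_card_le hcard
  refine ⟨Subtype.val ∘ Function.invFun e, ?_⟩
  rw [(Function.invFun_surjective e.injective).range_comp, Subtype.range_coe]

theorem isTight_badWords (h0 : ∅ ∈ S) : IsTight S (badWords S k) := by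
  rintro T hT hcard ⟨l, hl⟩
  obtain ⟨g, rfl⟩ := exists_range_eq_of_encard_le (nonempty_of_mem_bad h0 hT) hcard
  have hgl : ∀ i, (g i).length = l := fun i => hl _ ⟨i, rfl⟩
  let w : Word A k := List.ofFn fun (n : Fin l) i => (g i)[n.1]'(by rw [hgl]; exact n.2)
  have hw : unzip w = Set.range g := by
    refine congrArg Set.range (funext fun i => ?_)
    exact List.ext_getElem (by simp [w, hgl]) fun n _ _ => by simp [w]
  exact ⟨w, by rwa [mem_badWords, hw], hw⟩

theorem IsKSafety.isRepresentation_badWords (hS : IsKSafety S k) (h0 : ∅ ∈ S) :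
    IsRepresentation S (badWords S k) := by
  refine HyperLearn.isRepresentation_badWords fun T' hT' => ?_
  obtain ⟨T, hT, hcard, hTT'⟩ := hS T' hT'
  obtain ⟨g, rfl⟩ := exists_range_eq_of_encard_le (nonempty_of_mem_bad h0 hT) hcard
  choose t ht hgt using fun i => hTT' _ ⟨i, rfl⟩
  let τ : Stream' (Fin k → A) := fun n i => t i n
  let l := Finset.univ.sup fun i => (g i).length
  refine ⟨τ.take l, mem_bad_of_prefix hT ?_,
    setPrefix_unzip_iff.2 ⟨τ, tracePrefix_take τ l, ?_⟩⟩
  · rintro _ ⟨i, rfl⟩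
    refine ⟨_, ⟨i, rfl⟩, ?_⟩
    change g i <+: List.map _ (τ.take l)
    rw [map_take]
    exact (hgt i).prefix_take (Finset.le_sup (f := fun i => (g i).length) (Finset.mem_univ i))
  · rintro _ ⟨i, rfl⟩
    exact ht i

theorem eq_badWords_of_isTight {L : Language (Fin k → A)} (hL : IsRepresentation S L)
    (ht : IsTight S L) (hp : IsPermComplete L) : L = badWords S k := by
  ext w
  refine ⟨hL.1 w, fun hw => ?_⟩
  have hcard : (unzip w).encard ≤ (k : ℕ) := by
    rw [unzip, ← Set.image_univ]
    exact (Set.encard_image_le _ _).trans (by simp)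
  obtain ⟨v, hv, hvw⟩ := ht _ hw hcard ⟨w.length, by rintro _ ⟨i, rfl⟩; simp⟩
  exact hp v hv w hvw.symm

theorem unzip_map_extendLetter (h : c ≤ k) (w : Word A c) :
    unzip (w.map (extendLetter k)) = unzip w := by
  have hck : (c : ℕ) ≤ k := h
  apply Set.Subset.antisymm
  · rintro _ ⟨i, rfl⟩
    exact ⟨⟨min i (c - 1), by have := c.pos; omega⟩, by simp [extendLetter]⟩
  · rintro _ ⟨i, rfl⟩
    refine ⟨⟨i, by omega⟩, ?_⟩
    have : min (i : ℕ) (c - 1) = i := by omega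
    simp [extendLetter, this]

theorem map_extendLetter_mem_badWords_iff (h : c ≤ k) {w : Word A c} :
    w.map (extendLetter k) ∈ badWords S k ↔ w ∈ badWords S c := by
  rw [mem_badWords, unzip_map_extendLetter h, mem_badWords]

theorem IsRegularHyper.exists_isTargetArity (h : IsRegularHyper S) :
    ∃ κ, IsTargetArity S κ := by
  obtain ⟨κ, hκ, hmin⟩ := WellFounded.has_min (wellFounded_lt (α := ℕ+))
    {k | HasBadPrefixAutomaton S k} h
  exact ⟨κ, hκ, fun k' hk' hb => hmin k' hb hk'⟩

theorem IsTargetArity.le_of_isRepresentation {κ : ℕ+} (hκ : IsTargetArity S κ)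
    {L : Language (Fin k → A)} (hreg : L.IsRegular) (hL : IsRepresentation S L) : κ ≤ k :=
  not_lt.1 fun hk => hκ.2 k hk ⟨L, hreg, hL⟩

end BadPrefixes

namespace IsRepresentation

variable {A : Type} {S : Hyperproperty A} {k c : ℕ+} {L : Language (Fin c → A)}

theorem notMem_mono (hL : IsRepresentation S L) {T' U' : Set (ℕ → A)} (hT : T' ∉ S)
    (h : T' ⊆ U') : U' ∉ S := by
  obtain ⟨w, hw, hp, hb⟩ := (hL.2 T').1 hT
  exact (hL.2 U').2 ⟨w, hw, hp.mono_right h, hb⟩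

theorem empty_mem (hL : IsRepresentation S L) : ∅ ∈ S := by
  by_contra h
  obtain ⟨w, -, hp, -⟩ := (hL.2 ∅).1 h
  obtain ⟨t', ht', -⟩ := hp _ ⟨⟨0, c.pos⟩, rfl⟩
  exact ht'.elim

theorem badWords (hL : IsRepresentation S L) : IsRepresentation S (badWords S c) := by
  refine isRepresentation_badWords fun T' hT' => ?_
  obtain ⟨w, -, hp, hb⟩ := (hL.2 T').1 hT'
  exact ⟨w, hb, hp⟩

theorem mem_badWords_iff (hL : IsRepresentation S L) {w : Word A k} :
    w ∈ HyperLearn.badWords S k ↔ ∀ τ, unzipω (w ++ₛ τ) ∉ S := by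
  constructor
  · exact fun h τ => h _ (tracePrefix_append w τ).setPrefix_unzip
  · intro h T' hT'
    obtain ⟨τ, hτ, hsub⟩ := setPrefix_unzip_iff.1 hT'
    obtain ⟨τ', rfl⟩ := tracePrefix_iff_exists_append.1 hτ
    exact hL.notMem_mono (h τ') hsub

theorem unzipω_notMem_iff (hL : IsRepresentation S L) {τ : Stream' (Fin k → A)} :
    unzipω τ ∉ S ↔ ∃ (n : ℕ) (f : Fin c → Fin k), permute f (τ.take n) ∈ L := by
  rw [hL.2]
  constructor
  · rintro ⟨w, hw, hp, -⟩
    obtain ⟨f, hf⟩ := setPrefix_unzip_unzipω_iff.1 hp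
    exact ⟨w.length, f, by rwa [hf]⟩
  · rintro ⟨n, f, h⟩
    exact ⟨_, h, setPrefix_unzip_unzipω_iff.2 ⟨f, by simp [permute]⟩, hL.1 _ h⟩

theorem unzipω_append_notMem_iff (hL : IsRepresentation S L) {w : Word A k}
    {τ : Stream' (Fin k → A)} :
    unzipω (w ++ₛ τ) ∉ S ↔ (∃ p, p <+: w ∧ ∃ f : Fin c → Fin k, permute f p ∈ L) ∨
      ∃ (f : Fin c → Fin k) (n : ℕ), permute f (w ++ τ.take n) ∈ L := by
  rw [hL.unzipω_notMem_iff]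
  constructor
  · rintro ⟨n, f, h⟩
    rcases le_total n w.length with hn | hn
    · rw [take_append_of_le_length _ _ _ hn] at h
      exact .inl ⟨_, List.take_prefix n w, f, h⟩
    · obtain ⟨n, rfl⟩ := Nat.exists_eq_add_of_le hn
      exact .inr ⟨f, n, by rwa [append_take]⟩
  · rintro (⟨p, hp, f, h⟩ | ⟨f, n, h⟩)
    · refine ⟨p.length, f, ?_⟩
      rwa [take_append_of_le_length _ _ _ hp.length_le, ← List.prefix_iff_eq_take.1 hp]
    · exact ⟨w.length + n, f, by rwa [← append_take]⟩

theorem append_mem_badWords_iff (hL : IsRepresentation S L) {w u : Word A k} :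
    w ++ u ∈ HyperLearn.badWords S k ↔
      (∃ p, p <+: w ∧ ∃ f : Fin c → Fin k, permute f p ∈ L) ∨
        ∀ τ, ∃ (f : Fin c → Fin k) (n : ℕ), permute f (w ++ (u ++ₛ τ).take n) ∈ L := by
  simp only [hL.mem_badWords_iff, append_append_stream, hL.unzipω_append_notMem_iff,
    forall_or_left]

theorem isRegular_badWords (hL : IsRepresentation S L) (hreg : L.IsRegular) (k : ℕ+) :
    (HyperLearn.badWords S k).IsRegular := by
  obtain ⟨σ, _, D, rfl⟩ := hreg
  let summary (w : Word A k) : Prop × ((Fin c → Fin k) → σ) :=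
    (∃ p, p <+: w ∧ ∃ f : Fin c → Fin k, permute f p ∈ D.accepts, fun f => D.eval (permute f w))
  have mem_accepts_iff (f : Fin c → Fin k) (w v : Word A k) : permute f (w ++ v) ∈ D.accepts ↔
      D.evalFrom ((summary w).2 f) (permute f v) ∈ D.accept := by
    rw [permute, List.map_append, DFA.mem_accepts, DFA.eval, DFA.evalFrom_of_append]
    rfl
  have hfac : (HyperLearn.badWords S k).leftQuotient.FactorsThrough summary := by
    intro w w' hw
    ext u
    simp only [Language.mem_leftQuotient, hL.append_mem_badWords_iff, mem_accepts_iff, hw]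
    exact or_congr_left (iff_of_eq (congrArg Prod.fst hw))
  obtain ⟨e, he⟩ := (Function.factorsThrough_iff _).1 hfac
  apply Language.IsRegular.of_finite_range_leftQuotient
  rw [he]
  exact (Set.finite_range e).subset (Set.range_comp_subset_range _ _)

end IsRepresentation

theorem exists_stream_forall_append_take_notMem {α : Type} {L : Language α}
    (h : ∀ w ∉ L, ∃ a, w ++ [a] ∉ L) {w : List α} (hw : w ∉ L) :
    ∃ τ : Stream' α, ∀ n, w ++ τ.take n ∉ L := by
  choose next hnext using fun v : {v // v ∉ L} => h v.1 v.2
  let g : ℕ → {v // v ∉ L} := fun n =>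
    Nat.rec ⟨w, hw⟩ (fun _ v => ⟨v.1 ++ [next v], hnext v⟩) n
  let τ : Stream' α := fun i => next (g i)
  have hg (n : ℕ) : (g n).1 = w ++ τ.take n := by
    induction n with
    | zero => exact (List.append_nil w).symm
    | succ n ih => rw [take_succ', ← List.append_assoc, ← ih]; rfl
  exact ⟨τ, fun n => hg n ▸ (g n).2⟩

theorem IsRepresentation.eq_badWords_of_closed {A : Type} {S : Hyperproperty A} {k : ℕ+}
    {L : Language (Fin k → A)} (hL : IsRepresentation S L) (hsnoc : ∀ w ∈ L, ∀ a, w ++ [a] ∈ L)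
    (hcont : ∀ w ∉ L, ∃ a, w ++ [a] ∉ L)
    (hperm : ∀ (f : Fin k → Fin k) (w : Word A k), permute f w ∈ L → w ∈ L) :
    L = HyperLearn.badWords S k := by
  have happend (u w : Word A k) (hw : w ∈ L) : w ++ u ∈ L := by
    induction u generalizing w with
    | nil => simpa using hw
    | cons a u ih => simpa using ih _ (hsnoc w hw a)
  ext w
  refine ⟨hL.1 w, fun hbad => ?_⟩
  by_contra hw
  obtain ⟨τ, hτ⟩ := exists_stream_forall_append_take_notMem hcont hw
  rcases hL.unzipω_append_notMem_iff.1 (hL.mem_badWords_iff.1 hbad τ) with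
    ⟨p, ⟨u, rfl⟩, f, hp⟩ | ⟨f, n, h⟩
  · exact hw (happend u p (hperm f p hp))
  · exact hτ n (hperm f _ h)

end BadPrefixes

/-! ### Observation tables -/

section InsertNew

variable {α β : Type} [DecidableEq β]

/-- Append `x` to a list unless the list has an element with the same value of `f`. The loops of
the learner that collect rows, words or pairs of states without repetition are folds of this
operation. -/
def insertNew (f : α → β) (l : List α) (x : α) : List α :=
  if f x ∈ l.map f then l else l ++ [x]

variable {f : α → β}

theorem nodup_map_insertNew {l : List α} (h : (l.map f).Nodup) (x : α) :
    ((insertNew f l x).map f).Nodup := by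
  unfold insertNew
  split_ifs with hx
  · exact h
  · rw [List.map_append, List.map_singleton]
    simpa using h.concat hx

theorem prefix_insertNew (l : List α) (x : α) : l <+: insertNew f l x := by
  unfold insertNew
  split_ifs
  exacts [List.prefix_rfl, List.prefix_append l [x]]

theorem mem_or_eq_of_mem_insertNew {l : List α} {x y : α} (h : y ∈ insertNew f l x) :
    y ∈ l ∨ y = x := by
  unfold insertNew at h
  split_ifs at h
  · exact .inl h
  · simpa using h

theorem map_mem_insertNew (l : List α) (x : α) : f x ∈ (insertNew f l x).map f := by
  unfold insertNew
  split_ifs with hx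
  · exact hx
  · simp

theorem length_insertNew_le (l : List α) (x : α) : (insertNew f l x).length ≤ l.length + 1 := by
  unfold insertNew
  split_ifs <;> simp

theorem nodup_map_foldl_insertNew (l : List α) {base : List α} (h : (base.map f).Nodup) :
    ((l.foldl (insertNew f) base).map f).Nodup := by
  induction l generalizing base with
  | nil => exact h
  | cons x _ ih => exact ih (nodup_map_insertNew h x)

theorem prefix_foldl_insertNew (l base : List α) : base <+: l.foldl (insertNew f) base := by
  induction l generalizing base with
  | nil => exact List.prefix_rfl
  | cons x _ ih => exact (prefix_insertNew base x).trans (ih _)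

theorem mem_or_mem_of_mem_foldl_insertNew {l base : List α} {y : α}
    (h : y ∈ l.foldl (insertNew f) base) : y ∈ base ∨ y ∈ l := by
  induction l generalizing base with
  | nil => exact .inl h
  | cons x l ih =>
    rcases ih h with h | h
    · exact (mem_or_eq_of_mem_insertNew h).imp_right (by simp [·])
    · exact .inr (List.mem_cons_of_mem x h)

theorem map_mem_foldl_insertNew {l base : List α} {x : α} (h : x ∈ l) :
    f x ∈ (l.foldl (insertNew f) base).map f := by
  induction l generalizing base with
  | nil => simp at h
  | cons y l ih =>
    rcases List.mem_cons.1 h with rfl | h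
    · exact ((prefix_foldl_insertNew l _).map f).subset (map_mem_insertNew base x)
    · exact ih h

theorem length_foldl_insertNew_le (l base : List α) :
    (l.foldl (insertNew f) base).length ≤ base.length + l.length := by
  induction l generalizing base with
  | nil => exact le_rfl
  | cons x l ih =>
    have hstep := length_insertNew_le (f := f) base x
    have hrest := ih (insertNew f base x)
    simp only [List.foldl_cons, List.length_cons]
    omega

end InsertNew

theorem exists_findSome?_ite_eq_some {α β : Type} {l : List α} {p : α → Prop} [DecidablePred p]
    (g : α → β) (h : ∃ x ∈ l, p x) :
    ∃ x ∈ l, p x ∧ l.findSome? (fun x => if p x then some (g x) else none) = some (g x) := by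
  induction l with
  | nil => simp at h
  | cons x l ih =>
    by_cases hx : p x
    · exact ⟨x, List.mem_cons_self, hx, by simp [hx]⟩
    · obtain ⟨y, hy, hpy, heq⟩ := ih (by simpa [hx] using h)
      exact ⟨y, List.mem_cons_of_mem x hy, hpy, by simpa [hx] using heq⟩

section Words

variable {A : Type} {k : ℕ+}

theorem mem_letters [Fintype A] (a : Fin k → A) : a ∈ (letters A k).val :=
  mem_tuples fun _ => by simp

theorem length_letters [Fintype A] : (letters A k).val.length = Fintype.card A ^ (k : ℕ) := by
  simp [letters, length_tuples]

@[simp] theorem eqRow_val (r r' : List Bool) : (eqRow r r').val = decide (r = r') := rfl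

@[simp] theorem eqWord_val [DecidableEq A] (w w' : Word A k) :
    (eqWord w w').val = decide (w = w') := rfl

@[simp] theorem concat_val (w w' : Word A k) : (concat w w').val = w ++ w' := rfl

@[simp] theorem concat_time (w w' : Word A k) :
    (concat w w').time = k * (w.length + w'.length) + 1 := rfl

@[simp] theorem ask_val (T : Teacher A) (w : Word A k) : (ask T w).val = T.member k w := rfl

@[simp] theorem ask_time (T : Teacher A) (w : Word A k) :
    (ask T w).time = k * w.length + 1 := rfl

end Words

section Tables

variable {A : Type} [Fintype A] {k : ℕ+} (T : Teacher A) (S E : List (Word A k))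

omit [Fintype A] in
/-- The row of a word: the membership answers for its continuations by the separating sequences. -/
def rowOf (w : Word A k) : List Bool := E.map fun e => T.member k (w ++ e)

/-- The line of an observation table that belongs to the accessing sequence `s`. -/
noncomputable def entryOf (s : Word A k) : Entry A k :=
  ⟨s, rowOf T E s, (letters A k).val.map fun a => (a, rowOf T E (s ++ [a]))⟩

/-- The observation table with accessing sequences `S` and separating sequences `E`. -/
noncomputable def tableOf : Table A k := ⟨E, S.map (entryOf T E)⟩

omit [Fintype A] in
@[simp] theorem askRow_val (w : Word A k) : (askRow T E w).val = rowOf T E w := by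
  simp [askRow, rowOf]

theorem fill_val : (fill T S E).val = tableOf T S E := by
  simp [fill, tableOf, entryOf]

theorem accessing_val : (accessing (tableOf T S E)).val = S := by
  simp [accessing, tableOf, entryOf, Function.comp_def]

omit [Fintype A] in
/-- Consistency of an observation table. -/
def Consistent : Prop :=
  ∀ s ∈ S, ∀ t ∈ S, rowOf T E s = rowOf T E t → ∀ a, rowOf T E (s ++ [a]) = rowOf T E (t ++ [a])

omit [Fintype A] in
/-- Closedness of an observation table. -/
def Closed : Prop := ∀ s ∈ S, ∀ a, ∃ t ∈ S, rowOf T E (s ++ [a]) = rowOf T E t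

variable {T S E}

theorem inconsistency_val : (inconsistency (tableOf T S E)).val =
    S.findSome? fun s => S.findSome? fun t =>
      if rowOf T E s = rowOf T E t then
        (letters A k).val.findSome? fun a => E.findSome? fun e =>
          if T.member k (s ++ [a] ++ e) = T.member k (t ++ [a] ++ e) then none
          else some (a :: e)
      else none := by
  have zip_map_self (g : Word A k → Bool × Bool) : E.zip (E.map g) = E.map fun e => (e, g e) := by
    simpa using List.zip_map' (f := id) (g := g) (l := E)
  simp only [inconsistency, tableOf, findSome_val, List.findSome?_map]
  congr! 2 with s
  simp only [Function.comp_apply]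
  congr! 2 with t
  simp only [Function.comp_apply, bind_val, eqRow_val, entryOf, List.zip_map']
  by_cases h : rowOf T E s = rowOf T E t
  · simp only [h, decide_true, if_true, findSome_val, List.findSome?_map]
    congr! 2 with a
    simp only [Function.comp_apply, rowOf, List.zip_map', zip_map_self, List.findSome?_map]
    congr! 2 with e
    simp only [Function.comp_apply, List.append_assoc, List.singleton_append]
    by_cases he : T.member k (s ++ a :: e) = T.member k (t ++ a :: e)
    · rw [if_pos he, beq_iff_eq.2 he, pure_val]
    · rw [if_neg he, beq_eq_false_iff_ne.2 he, bind_val, concat_val, pure_val]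
      rfl
  · simp [h]

theorem consistent_of_inconsistency (h : (inconsistency (tableOf T S E)).val = none) :
    Consistent T S E := by
  simp only [inconsistency_val, List.findSome?_eq_none_iff] at h
  intro s hs t ht hst a
  have hsame := h s hs t ht
  rw [if_pos hst, List.findSome?_eq_none_iff] at hsame
  refine List.map_congr_left fun e he => ?_
  simpa using List.findSome?_eq_none_iff.1 (hsame a (mem_letters a)) e he

theorem exists_of_inconsistency {v : Word A k}
    (h : (inconsistency (tableOf T S E)).val = some v) :
    ∃ s ∈ S, ∃ t ∈ S, ∃ a, ∃ e ∈ E, v = a :: e ∧ rowOf T E s = rowOf T E t ∧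
      T.member k (s ++ v) ≠ T.member k (t ++ v) := by
  rw [inconsistency_val] at h
  obtain ⟨s, hs, h⟩ := List.exists_of_findSome?_eq_some h
  obtain ⟨t, ht, h⟩ := List.exists_of_findSome?_eq_some h
  split_ifs at h with hst
  obtain ⟨a, -, h⟩ := List.exists_of_findSome?_eq_some h
  obtain ⟨e, he, h⟩ := List.exists_of_findSome?_eq_some h
  split_ifs at h with hne
  obtain rfl : a :: e = v := Option.some.inj h
  exact ⟨s, hs, t, ht, a, e, he, rfl, hst, by simpa using hne⟩

theorem unclosed_val : (unclosed (tableOf T S E)).val =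
    S.findSome? fun s => (letters A k).val.findSome? fun a =>
      if ∃ t ∈ S, rowOf T E (s ++ [a]) = rowOf T E t then none else some (s ++ [a]) := by
  simp only [unclosed, tableOf, findSome_val, List.findSome?_map]
  congr! 2 with s
  simp only [Function.comp_apply, entryOf, List.findSome?_map]
  congr! 2 with a
  simp only [Function.comp_apply, bind_val, any_val, eqRow_val, List.any_map, Function.comp_def]
  change (match S.any fun t => decide (rowOf T E (s ++ [a]) = rowOf T E t) with
    | true => pure none
    | false => do return some (← concat s [a])).val = _
  by_cases h : ∃ t ∈ S, rowOf T E (s ++ [a]) = rowOf T E t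
  · have hany : (S.any fun t => decide (rowOf T E (s ++ [a]) = rowOf T E t)) = true := by
      simpa using h
    rw [if_pos h, hany, pure_val]
  · have hany : (S.any fun t => decide (rowOf T E (s ++ [a]) = rowOf T E t)) = false := by
      simpa using h
    rw [if_neg h, hany, bind_val, concat_val, pure_val]

theorem closed_of_unclosed (h : (unclosed (tableOf T S E)).val = none) : Closed T S E := by
  simp only [unclosed_val, List.findSome?_eq_none_iff] at h
  intro s hs a
  simpa using h s hs a (mem_letters a)

theorem exists_of_unclosed {v : Word A k} (h : (unclosed (tableOf T S E)).val = some v) :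
    ∃ s ∈ S, ∃ a, v = s ++ [a] ∧ ∀ t ∈ S, rowOf T E v ≠ rowOf T E t := by
  rw [unclosed_val] at h
  obtain ⟨s, hs, h⟩ := List.exists_of_findSome?_eq_some h
  obtain ⟨a, -, h⟩ := List.exists_of_findSome?_eq_some h
  split_ifs at h with hst
  obtain rfl : s ++ [a] = v := Option.some.inj h
  push Not at hst
  exact ⟨s, hs, a, rfl, hst⟩

end Tables

section Conjectures

variable {A : Type} {k : ℕ+}

/-- The relation of a conjecture to the table it is made from: the state `i` stands for the row of
the accessing sequence `σ i`. -/
structure IsConjecture (T : Teacher A) (S E : List (Word A k)) (M : Conjecture A k)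
    (σ : Fin M.size → Word A k) : Prop where
  mem : ∀ i, σ i ∈ S
  start : rowOf T E (σ M.start) = rowOf T E []
  step : ∀ i a, rowOf T E (σ (M.step i a)) = rowOf T E (σ i ++ [a])
  accept : ∀ i, M.accept i = (rowOf T E (σ i)).headD false
  injective : Function.Injective fun i => rowOf T E (σ i)

/-- The first loop of `conjecture`: find the entry of the empty word. -/
def firstEntry (O : Table A k) : Timed (Option (Entry A k)) :=
  findSome (fun x => do
    match x.word with
    | [] => return some x
    | _ :: _ => return none) O.entries

/-- The body of the second loop of `conjecture`: add the entry `x` unless its row is the row of `x₀`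
or of an entry collected before. -/
def addEntry (x₀ : Entry A k) (xs : List (Entry A k)) (x : Entry A k) :
    Timed (List (Entry A k)) := do
  match ← Timed.any (fun y => eqRow x.row y.row) (x₀ :: xs) with
  | true => return xs
  | false => snoc xs x

/-- The second loop of `conjecture`: collect entries with different rows, other than that
of `x₀`. -/
def otherEntries (O : Table A k) (x₀ : Entry A k) : Timed (List (Entry A k)) :=
  fold (addEntry x₀) [] O.entries

theorem cons_addEntry_val (x₀ : Entry A k) (xs : List (Entry A k)) (x : Entry A k) :
    x₀ :: (addEntry x₀ xs x).val = insertNew Entry.row (x₀ :: xs) x := by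
  have hany : (Timed.any (fun y => eqRow x.row y.row) (x₀ :: xs)).val =
      decide (x.row ∈ (x₀ :: xs).map Entry.row) := by
    rw [any_val, Bool.eq_iff_iff]
    simp only [eqRow_val, List.any_eq_true, decide_eq_true_eq, List.mem_map, eq_comm (a := x.row)]
  rw [addEntry, insertNew, bind_val, hany]
  by_cases h : x.row ∈ (x₀ :: xs).map Entry.row
  · rw [if_pos h, decide_eq_true h, pure_val]
  · rw [if_neg h, decide_eq_false h, snoc_val, List.cons_append]

theorem cons_otherEntries_val (O : Table A k) (x₀ : Entry A k) :
    x₀ :: (otherEntries O x₀).val = O.entries.foldl (insertNew Entry.row) [x₀] := by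
  rw [otherEntries, fold_val]
  exact (List.foldl_hom (x₀ :: ·) fun xs x => (cons_addEntry_val x₀ xs x).symm).symm

variable [DecidableEq A]

/-- The transition with the letter `a` from the state of the entry `state i`: look up the row `r` of
the successor, then the state `j` with this row. -/
def lookupStep {n : ℕ} (state : Fin (n + 1) → Entry A k) (i : Fin (n + 1)) (a : Fin k → A) :
    Timed (Fin (n + 1)) := do
  let r ← findSome (fun p => do
    tick (2 * k)
    return if p.1 = a then some p.2 else none) (state i).succ
  let j ← findSome (fun j => do
    match ← eqRow (r.getD []) (state j).row with
    | true => return some j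
    | false => return none) (List.finRange (n + 1))
  tick k
  return j.getD 0

theorem lookupStep_val {n : ℕ} (state : Fin (n + 1) → Entry A k) (i : Fin (n + 1))
    (a : Fin k → A) :
    let r := (state i).succ.findSome? fun p => if p.1 = a then some p.2 else none
    (lookupStep state i a).val = ((List.finRange _).findSome? fun j =>
      if r.getD [] = (state j).row then some j else none).getD 0 := by
  simp only [lookupStep, bind_val, pure_val, findSome_val, eqRow_val]
  congr! 3 with j
  split <;> simp_all

variable [Fintype A]

/-- The last part of `conjecture`: build the automaton whose states are given entries. -/
def conjectureOf (x₀ : Entry A k) (others : List (Entry A k)) : Timed (Conjecture A k) := do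
  tick (others.length + 1)
  let state : Fin (others.length + 1) → Entry A k := (x₀ :: others).get
  let step ← tabulate fun i => tabulate fun a : Fin k → A => lookupStep state i a
  let accept ← tabulate fun i => do
    tick 1
    return (state i).row.headD false
  return ⟨others.length, step, 0, accept⟩

theorem conjecture_eq (O : Table A k) : conjecture O = (do
    let x₀ ← firstEntry O
    let x₀ : Entry A k := x₀.getD ⟨[], [], []⟩
    let others ← otherEntries O x₀
    conjectureOf x₀ others) := rfl

variable {T : Teacher A} {S E : List (Word A k)}

omit [DecidableEq A] in
theorem firstEntry_val (h : [] ∈ S) :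
    (firstEntry (tableOf T S E)).val = some (entryOf T E []) := by
  obtain ⟨_, -, rfl, heq⟩ := exists_findSome?_ite_eq_some (entryOf T E) ⟨[], h, rfl⟩
  rw [firstEntry, findSome_val, tableOf, List.findSome?_map, ← heq]
  congr! 2 with s
  cases s <;> simp [entryOf]

theorem findSome?_succ_entryOf (s : Word A k) (a : Fin k → A) :
    (entryOf T E s).succ.findSome? (fun p => if p.1 = a then some p.2 else none) =
      some (rowOf T E (s ++ [a])) := by
  obtain ⟨b, -, rfl, heq⟩ := exists_findSome?_ite_eq_some (p := (· = a))
    (fun b => rowOf T E (s ++ [b])) ⟨a, mem_letters a, rfl⟩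
  rw [← heq, entryOf, List.findSome?_map]
  rfl

theorem isConjecture_conjectureOf (hcl : Closed T S E) {x₀ : Entry A k} {others : List (Entry A k)}
    (hx₀ : x₀ = entryOf T E []) (hnodup : ((x₀ :: others).map Entry.row).Nodup)
    (hcover : ∀ t ∈ S, rowOf T E t ∈ (x₀ :: others).map Entry.row)
    {σ : Fin (others.length + 1) → Word A k} (hσ : ∀ i, σ i ∈ S)
    (hσ_entry : ∀ i, (x₀ :: others).get i = entryOf T E (σ i)) :
    IsConjecture T S E (conjectureOf x₀ others).val σ := by
  have hrow (i) : ((x₀ :: others).get i).row = rowOf T E (σ i) := by rw [hσ_entry]; rfl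
  refine ⟨hσ, ?_, fun i a => ?_, fun i => congrArg (·.headD false) (hrow i), fun i j hij => ?_⟩
  · exact (hrow 0).symm.trans (congrArg Entry.row hx₀)
  · have hex : ∃ j ∈ List.finRange (others.length + 1),
        rowOf T E (σ i ++ [a]) = ((x₀ :: others).get j).row := by
      obtain ⟨t, ht, hat⟩ := hcl (σ i) (hσ i) a
      obtain ⟨x, hx, hxt⟩ := List.mem_map.1 (hcover t ht)
      obtain ⟨j, rfl⟩ := List.get_of_mem hx
      exact ⟨j, List.mem_finRange j, hat.trans hxt.symm⟩
    obtain ⟨j, -, hj, heq⟩ := exists_findSome?_ite_eq_some id hex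
    have hstep : (conjectureOf x₀ others).val.step i a = j := by
      refine (lookupStep_val _ i a).trans (Eq.trans ?_ (congrArg (·.getD 0) heq))
      simp only [hσ_entry i, findSome?_succ_entryOf]
      rfl
    rw [hstep, hj, hrow]
  · refine List.nodup_iff_injective_get.1 (List.Nodup.of_map _ hnodup) ?_
    refine List.inj_on_of_nodup_map hnodup (List.get_mem _ _) (List.get_mem _ _) ?_
    exact (hrow i).trans (Eq.trans hij (hrow j).symm)

theorem exists_isConjecture (h0 : [] ∈ S) (hcl : Closed T S E) :
    ∃ σ, IsConjecture T S E (conjecture (tableOf T S E)).val σ := by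
  have hentries := cons_otherEntries_val (tableOf T S E) (entryOf T E [])
  rw [conjecture_eq, bind_val, firstEntry_val h0, Option.getD_some, bind_val]
  generalize (otherEntries (tableOf T S E) (entryOf T E [])).val = others at hentries ⊢
  have hmem : ∀ x ∈ entryOf T E [] :: others, ∃ s ∈ S, x = entryOf T E s := by
    rw [hentries]
    intro x hx
    rcases mem_or_mem_of_mem_foldl_insertNew hx with h | h
    · exact ⟨[], h0, List.mem_singleton.1 h⟩
    · obtain ⟨s, hs, h⟩ := List.mem_map.1 h
      exact ⟨s, hs, h.symm⟩
  choose σ hσ hσ_entry using fun i => hmem _ (List.get_mem _ i)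
  refine ⟨σ, isConjecture_conjectureOf hcl rfl ?_ (fun t ht => ?_) hσ hσ_entry⟩
  · rw [hentries]
    exact nodup_map_foldl_insertNew _ (by simp)
  · rw [hentries]
    exact map_mem_foldl_insertNew (List.mem_map_of_mem ht)

end Conjectures

section PowerBounds

variable {B x y a b : ℕ}

theorem add_le_pow (hB : 2 ≤ B) (hx : x ≤ B ^ a) (hy : y ≤ B ^ b) : x + y ≤ B ^ (a + b + 1) := by
  have hpos : 0 < B := by omega
  calc x + y ≤ B ^ (a + b) + B ^ (a + b) := by
        gcongr
        · exact hx.trans (Nat.pow_le_pow_right hpos (Nat.le_add_right a b))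
        · exact hy.trans (Nat.pow_le_pow_right hpos (Nat.le_add_left b a))
    _ = B ^ (a + b) * 2 := (mul_two _).symm
    _ ≤ B ^ (a + b) * B := Nat.mul_le_mul_left _ hB

theorem mul_le_pow (hx : x ≤ B ^ a) (hy : y ≤ B ^ b) : x * y ≤ B ^ (a + b) :=
  (Nat.mul_le_mul hx hy).trans_eq (pow_add B a b).symm

theorem one_le_pow_zero : 1 ≤ B ^ 0 := (pow_zero B).ge

theorem le_pow_one (h : x ≤ B) : x ≤ B ^ 1 := h.trans (pow_one B).ge

theorem le_pow_of_le (hB : 2 ≤ B) (hx : x ≤ B ^ a) (h : a ≤ b) : x ≤ B ^ b :=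
  hx.trans (Nat.pow_le_pow_right (by omega) h)

theorem mul_succ_succ_le_pow (hB : 2 ≤ B) (hx : x ≤ B ^ a) (hy : y ≤ B ^ b) :
    x * (y + 1) + 1 ≤ B ^ (a + b + 2) :=
  le_pow_of_le hB
    (add_le_pow hB (mul_le_pow hx (add_le_pow hB hy one_le_pow_zero)) one_le_pow_zero) (by omega)

theorem tuples_time_le_pow {β : Type} {l : List β} {k : ℕ} (hB : 2 ≤ B) (hk : k ≤ B)
    (hl : (l.length + 1) ^ k ≤ B) : (tuples l k).time ≤ B ^ 7 := by
  have hk2 : k + 2 ≤ B ^ 3 := add_le_pow hB (le_pow_one hk) (le_pow_one hB)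
  calc (tuples l k).time ≤ (k + 2) ^ 2 * (l.length + 1) ^ k := tuples_time_le l k
    _ ≤ (B ^ 3) ^ 2 * B := by gcongr
    _ = B ^ 7 := by ring

end PowerBounds

/-! ### The search for violations of permutation-completeness -/

section Search

variable {A : Type} {k : ℕ+} (M : Conjecture A k) (f : Fin k → Fin k)

/-- A node of the search: a word and the pair of states that it leads to in the product
automaton. -/
abbrev SearchNode : Type := Word A k × Fin M.size × Fin M.size

/-- The transition function of the product automaton: the first component reads permuted letters. -/
def pairStep (p : Fin M.size × Fin M.size) (a : Fin k → A) : Fin M.size × Fin M.size :=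
  (M.step p.1 (a ∘ f), M.step p.2 a)

/-- The treatment of the letter `a` at the node `x` in a round of the search. -/
def searchStep (x : SearchNode M) (acc : List (SearchNode M)) (a : Fin k → A) :
    Timed (List (SearchNode M)) := do
  tick (4 * k)
  match ← Timed.any (fun y => do
      tick 2
      return decide (y.2 = pairStep M f x.2 a)) acc with
  | true => return acc
  | false =>
    let w ← concat x.1 [a]
    snoc acc (w, pairStep M f x.2 a)

/-- The successors of the nodes `vis`, with the pairs of states that are already known not yet
removed. -/
def searchSuccessors (as : List (Fin k → A)) (vis : List (SearchNode M)) : List (SearchNode M) :=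
  vis.flatMap fun x => as.map fun a => (x.1 ++ [a], pairStep M f x.2 a)

/-- The invariant of the search after `r` rounds: different nodes have different pairs of states,
and the pair of states of a node is reached by its word, whose length is at most `r`. -/
structure SearchInv (r : ℕ) (vis : List (SearchNode M)) : Prop where
  eval : ∀ y ∈ vis, y.2 = (M.toDFA.eval (permute f y.1), M.toDFA.eval y.1)
  word_length_le : ∀ y ∈ vis, y.1.length ≤ r
  nodup : (vis.map Prod.snd).Nodup

variable {M f}

theorem searchRound_eq (as : List (Fin k → A)) (vis : List (SearchNode M)) :
    searchRound M f as vis = fold (fun acc x => fold (searchStep M f x) acc as) vis vis := rfl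

theorem searchStep_val (x : SearchNode M) (acc : List (SearchNode M)) (a : Fin k → A) :
    (searchStep M f x acc a).val = insertNew Prod.snd acc (x.1 ++ [a], pairStep M f x.2 a) := by
  have hany : acc.any (fun y => decide (y.2 = pairStep M f x.2 a)) =
      decide (pairStep M f x.2 a ∈ acc.map Prod.snd) := by
    rw [Bool.eq_iff_iff]
    simp only [List.any_eq_true, decide_eq_true_eq, List.mem_map]
  simp only [searchStep, bind_val, any_val, pure_val, hany, insertNew]
  by_cases h : pairStep M f x.2 a ∈ acc.map Prod.snd
  · rw [decide_eq_true h, if_pos h, pure_val]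
  · rw [decide_eq_false h, if_neg h, bind_val, concat_val, snoc_val]

theorem searchStep_time_le (x : SearchNode M) (acc : List (SearchNode M)) (a : Fin k → A) :
    (searchStep M f x acc a).time ≤
      4 * k + (acc.length * 3 + 1 + (k * (x.1.length + 1) + 1 + (acc.length + 1))) := by
  simp only [searchStep, bind_time, tick_time]
  gcongr
  · exact any_time_le (c := 2) (by simp)
  · split <;> simp

theorem searchRound_val (as : List (Fin k → A)) (vis : List (SearchNode M)) :
    (searchRound M f as vis).val =
      (searchSuccessors M f as vis).foldl (insertNew Prod.snd) vis := by
  simp only [searchRound_eq, fold_val, searchStep_val, searchSuccessors, List.foldl_flatMap,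
    List.foldl_map]

theorem pairStep_eval (w : Word A k) (a : Fin k → A) :
    pairStep M f (M.toDFA.eval (permute f w), M.toDFA.eval w) a =
      (M.toDFA.eval (permute f (w ++ [a])), M.toDFA.eval (w ++ [a])) := by
  rw [permute, permute, List.map_append, List.map_singleton, DFA.eval_append_singleton,
    DFA.eval_append_singleton]
  rfl

theorem length_le_of_nodup_map_snd {vis : List (SearchNode M)} (h : (vis.map Prod.snd).Nodup) :
    vis.length ≤ M.size * M.size := by
  simpa using h.length_le_card

namespace SearchInv

variable {r : ℕ} {vis : List (SearchNode M)}

theorem start : SearchInv M f 0 [([], M.start, M.start)] :=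
  ⟨fun _ hy => by rw [List.mem_singleton.1 hy]; rfl, by simp, by simp⟩

theorem searchRound_val (h : SearchInv M f r vis) (as : List (Fin k → A)) :
    SearchInv M f (r + 1) (searchRound M f as vis).val := by
  have hsucc : ∀ y ∈ searchSuccessors M f as vis,
      y.2 = (M.toDFA.eval (permute f y.1), M.toDFA.eval y.1) ∧ y.1.length ≤ r + 1 := by
    intro y hy
    obtain ⟨x, hx, hy⟩ := List.mem_flatMap.1 hy
    obtain ⟨a, -, rfl⟩ := List.mem_map.1 hy
    exact ⟨by rw [h.eval x hx, pairStep_eval], by simpa using h.word_length_le x hx⟩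
  rw [_root_.HyperLearn.searchRound_val]
  refine ⟨fun y hy => ?_, fun y hy => ?_, nodup_map_foldl_insertNew _ h.nodup⟩
  all_goals rcases mem_or_mem_of_mem_foldl_insertNew hy with hy | hy
  exacts [h.eval y hy, (hsucc y hy).1, (h.word_length_le y hy).trans r.le_succ, (hsucc y hy).2]

theorem search_val (h : SearchInv M f r vis) (as : List (Fin k → A)) (n : ℕ) :
    SearchInv M f (r + n) (search M f as n vis).val := by
  induction n generalizing r vis with
  | zero => exact h
  | succ n ih => exact Nat.succ_add_eq_add_succ r n ▸ ih (h.searchRound_val as)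

end SearchInv

section Closure

variable {as : List (Fin k → A)} {vis : List (SearchNode M)}

theorem prefix_searchRound : vis <+: (searchRound M f as vis).val :=
  searchRound_val as vis ▸ prefix_foldl_insertNew _ vis

theorem pairStep_mem_searchRound {x : SearchNode M} (hx : x ∈ vis) {a : Fin k → A} (ha : a ∈ as) :
    pairStep M f x.2 a ∈ (searchRound M f as vis).val.map Prod.snd := by
  rw [searchRound_val]
  exact map_mem_foldl_insertNew (x := (x.1 ++ [a], pairStep M f x.2 a))
    (List.mem_flatMap.2 ⟨x, hx, List.mem_map.2 ⟨a, ha, rfl⟩⟩)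

theorem prefix_search (n : ℕ) : vis <+: (search M f as n vis).val := by
  induction n generalizing vis with
  | zero => exact List.prefix_rfl
  | succ n ih => exact prefix_searchRound.trans ih

theorem search_eq_self (h : (searchRound M f as vis).val = vis) (n : ℕ) :
    (search M f as n vis).val = vis := by
  induction n with
  | zero => rfl
  | succ n ih =>
    change (search M f as n (searchRound M f as vis).val).val = vis
    rw [h, ih]

/-- A round that finds no new pair finds none ever after, so there are at most as many fruitful
rounds as pairs. -/
theorem pairStep_mem_search (hnodup : (vis.map Prod.snd).Nodup) {n : ℕ}
    (hn : M.size * M.size < vis.length + n) {x : SearchNode M}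
    (hx : x ∈ (search M f as n vis).val) {a : Fin k → A} (ha : a ∈ as) :
    pairStep M f x.2 a ∈ (search M f as n vis).val.map Prod.snd := by
  induction n generalizing vis with
  | zero => exact absurd (length_le_of_nodup_map_snd hnodup) (by omega)
  | succ n ih =>
    have hpre : vis <+: (searchRound M f as vis).val := prefix_searchRound
    change x ∈ (search M f as n (searchRound M f as vis).val).val at hx
    change _ ∈ (search M f as n (searchRound M f as vis).val).val.map Prod.snd
    rcases hpre.length_le.lt_or_eq with hlt | heq
    · refine ih ?_ (by omega) hx
      rw [searchRound_val]
      exact nodup_map_foldl_insertNew _ hnodup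
    · have hself : (searchRound M f as vis).val = vis := (hpre.eq_of_length heq).symm
      rw [hself, search_eq_self hself] at hx ⊢
      exact hself ▸ pairStep_mem_searchRound hx ha

theorem exists_mem_search_eval (has : ∀ a, a ∈ as) (w : Word A k) :
    ∃ y ∈ (search M f as (M.size * M.size) [([], M.start, M.start)]).val,
      y.2 = (M.toDFA.eval (permute f w), M.toDFA.eval w) := by
  induction w using List.reverseRecOn with
  | nil => exact ⟨_, (prefix_search _).subset (List.mem_singleton_self _), rfl⟩
  | append_singleton w a ih =>
    obtain ⟨y, hy, hyw⟩ := ih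
    have hstep := pairStep_mem_search (SearchInv.start (f := f)).nodup (by simp) hy (has a)
    rw [hyw, pairStep_eval] at hstep
    exact List.mem_map.1 hstep

end Closure

theorem mem_accepts_iff_accept_eval {w : Word A k} :
    w ∈ M.toDFA.accepts ↔ M.accept (M.toDFA.eval w) = true := .rfl

section Incompleteness

variable [Fintype A]

theorem incompleteness_val : (incompleteness M).val =
    (tuples (List.finRange k) k).val.findSome? fun f =>
      (search M f (letters A k).val (M.size * M.size) [([], M.start, M.start)]).val.findSome?
        fun x => if M.accept x.2.1 = true ∧ M.accept x.2.2 = false then some x.1 else none := by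
  simp [incompleteness]

theorem exists_of_incompleteness {w : Word A k} (h : (incompleteness M).val = some w) :
    ∃ f : Fin k → Fin k, permute f w ∈ M.toDFA.accepts ∧ w ∉ M.toDFA.accepts ∧
      w.length ≤ M.size * M.size := by
  rw [incompleteness_val] at h
  obtain ⟨f, -, h⟩ := List.exists_of_findSome?_eq_some h
  obtain ⟨x, hx, h⟩ := List.exists_of_findSome?_eq_some h
  split_ifs at h with hacc
  obtain rfl : x.1 = w := Option.some.inj h
  have hinv := SearchInv.start.search_val (M := M) (f := f) (letters A k).val (M.size * M.size)
  rw [hinv.eval x hx] at hacc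
  refine ⟨f, hacc.1, ?_, by simpa using hinv.word_length_le x hx⟩
  rw [mem_accepts_iff_accept_eval, hacc.2]
  exact Bool.false_ne_true

theorem mem_accepts_of_permute_of_incompleteness (h : (incompleteness M).val = none)
    {f : Fin k → Fin k} {w : Word A k} (hw : permute f w ∈ M.toDFA.accepts) :
    w ∈ M.toDFA.accepts := by
  simp only [incompleteness_val, List.findSome?_eq_none_iff] at h
  obtain ⟨y, hy, hyw⟩ := exists_mem_search_eval (M := M) (f := f) mem_letters w
  have hy := h f (mem_tuples fun _ => List.mem_finRange _) y hy
  rw [hyw] at hy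
  rw [mem_accepts_iff_accept_eval] at hw ⊢
  simpa [hw] using hy

end Incompleteness

section SearchTime

variable {B : ℕ} {as : List (Fin k → A)} {vis : List (SearchNode M)}

theorem searchStep_time_le_pow (hB : 4 ≤ B) (hk : (k : ℕ) ≤ B) (hM : M.size ≤ B)
    {x : SearchNode M} (hx : x.1.length ≤ B ^ 2) (hvis : (vis.map Prod.snd).Nodup)
    (a : Fin k → A) : (searchStep M f x vis a).time ≤ B ^ 17 := by
  have hB2 : 2 ≤ B := by omega
  have h3 : 3 ≤ B ^ 1 := le_pow_one (by omega)
  have hk1 : (k : ℕ) ≤ B ^ 1 := le_pow_one hk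
  have hlen : vis.length ≤ B ^ 2 :=
    (length_le_of_nodup_map_snd hvis).trans (mul_le_pow (le_pow_one hM) (le_pow_one hM))
  have hpow := add_le_pow hB2 (mul_le_pow (le_pow_one hB) hk1)
    (add_le_pow hB2 (add_le_pow hB2 (mul_le_pow hlen h3) one_le_pow_zero)
      (add_le_pow hB2 (add_le_pow hB2 (mul_le_pow hk1 (add_le_pow hB2 hx one_le_pow_zero))
        one_le_pow_zero) (add_le_pow hB2 hlen one_le_pow_zero)))
  exact le_pow_of_le hB2 ((searchStep_time_le x vis a).trans hpow) (by norm_num)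

theorem searchRound_time_le (hB : 4 ≤ B) (hk : (k : ℕ) ≤ B) (hM : M.size ≤ B)
    (has : as.length ≤ B) (hvis : (vis.map Prod.snd).Nodup)
    (hlen : ∀ x ∈ vis, x.1.length ≤ B ^ 2) : (searchRound M f as vis).time ≤ B ^ 24 := by
  have hB2 : 2 ≤ B := by omega
  have hletter (x) (hx : x ∈ vis) (acc : List (SearchNode M)) (hacc : (acc.map Prod.snd).Nodup) :
      ((fold (searchStep M f x) acc as).val.map Prod.snd).Nodup ∧
        (fold (searchStep M f x) acc as).time ≤ B ^ 20 := by
    refine (fold_invariant (c := B ^ 17)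
      (fun _ (acc : List (SearchNode M)) => (acc.map Prod.snd).Nodup)
      (fun _ acc a _ _ hacc => ⟨?_, ?_⟩) hacc).imp_right fun h => ?_
    · exact searchStep_val x acc a ▸ nodup_map_insertNew hacc _
    · exact searchStep_time_le_pow hB hk hM (hlen x hx) hacc a
    · exact h.trans (mul_succ_succ_le_pow hB2 (le_pow_one has) le_rfl)
  have hvis_length : vis.length ≤ B ^ 2 :=
    (length_le_of_nodup_map_snd hvis).trans (mul_le_pow (le_pow_one hM) (le_pow_one hM))
  rw [searchRound_eq]
  exact (fold_invariant (fun _ (acc : List (SearchNode M)) => (acc.map Prod.snd).Nodup)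
    (fun _ acc x hx _ hacc => hletter x hx acc hacc) hvis).2.trans
    (mul_succ_succ_le_pow hB2 hvis_length le_rfl)

theorem SearchInv.search_time_le {r n : ℕ} (h : SearchInv M f r vis) (hB : 4 ≤ B)
    (hk : (k : ℕ) ≤ B) (hM : M.size ≤ B) (has : as.length ≤ B) (hr : r + n ≤ B ^ 2) :
    (search M f as n vis).time ≤ n * (B ^ 24 + 1) + 1 := by
  induction n generalizing r vis with
  | zero => simp [search]
  | succ n ih =>
    have hround := searchRound_time_le (f := f) hB hk hM has h.nodup fun x hx =>
      (h.word_length_le x hx).trans ((Nat.le_add_right r _).trans hr)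
    have hrest := ih (h.searchRound_val as) (by omega)
    simp only [search, bind_time, tick_time]
    linarith

variable [Fintype A]

theorem length_letters_le (hA : (Fintype.card A + 1) ^ (k : ℕ) ≤ B) :
    (letters A k).val.length ≤ B :=
  length_letters.trans_le ((Nat.pow_le_pow_left (Nat.le_succ _) _).trans hA)

theorem letters_time_le (hB : 2 ≤ B) (hk : (k : ℕ) ≤ B)
    (hA : (Fintype.card A + 1) ^ (k : ℕ) ≤ B) : (letters A k).time ≤ B ^ 7 :=
  tuples_time_le_pow hB hk (by simpa using hA)

theorem incompleteness_time_le (hB : 4 ≤ B) (hk : (k : ℕ) ≤ B)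
    (hA : (Fintype.card A + 1) ^ (k : ℕ) ≤ B) (hkk : ((k : ℕ) + 1) ^ (k : ℕ) ≤ B)
    (hM : M.size ≤ B) : (incompleteness M).time ≤ B ^ 60 := by
  have hB2 : 2 ≤ B := by omega
  have hpairs : M.size * M.size ≤ B ^ 2 := mul_le_pow (le_pow_one hM) (le_pow_one hM)
  have hletters := letters_time_le (A := A) hB2 hk hA
  have htuples : (tuples (List.finRange k) k).time ≤ B ^ 7 :=
    tuples_time_le_pow hB2 hk (by simpa using hkk)
  have htuples_length : (tuples (List.finRange k) k).val.length ≤ B ^ 1 := by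
    rw [length_tuples, List.length_finRange]
    exact le_pow_one ((Nat.pow_le_pow_left (Nat.le_succ _) _).trans hkk)
  simp only [incompleteness, bind_time]
  refine le_pow_of_le hB2 (add_le_pow hB2 hletters (add_le_pow hB2 htuples
    ((findSome_time_le (c := B ^ 35) fun f _ => ?_).trans
      (mul_succ_succ_le_pow hB2 htuples_length le_rfl)))) (by norm_num)
  have hsearch := SearchInv.start.search_time_le (f := f) hB hk hM (length_letters_le hA)
    (n := M.size * M.size) (by simpa using hpairs)
  have hvisited := (length_le_of_nodup_map_snd (SearchInv.start.search_val (M := M) (f := f)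
    (letters A k).val (M.size * M.size)).nodup).trans hpairs
  simp only [bind_time]
  exact le_pow_of_le hB2 (add_le_pow hB2
    (hsearch.trans (mul_succ_succ_le_pow hB2 hpairs le_rfl))
    ((findSome_time_le (c := 2) (by simp)).trans
      (mul_succ_succ_le_pow hB2 hvisited (le_pow_one hB2)))) (by norm_num)

end SearchTime

end Search

/-! ### Amended and extended tables -/

section Amend

variable {A : Type} [DecidableEq A] {k : ℕ+}

/-- The body of the loop of `amend`: add a word unless it is already there. -/
def addWord (S : List (Word A k)) (v : Word A k) : Timed (List (Word A k)) := do
  match ← Timed.any (fun s => eqWord s v) S with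
  | true => return S
  | false => snoc S v

/-- The accessing sequences of a table amended with `w`. -/
def withPrefixes (S : List (Word A k)) (w : Word A k) : List (Word A k) :=
  w.inits.foldl (insertNew id) S

theorem addWord_val (S : List (Word A k)) (v : Word A k) :
    (addWord S v).val = insertNew id S v := by
  have hany : (Timed.any (fun s => eqWord s v) S).val = decide (v ∈ S) := by
    rw [any_val, Bool.eq_iff_iff]
    simp
  simp only [addWord, insertNew, bind_val, hany, List.map_id, id]
  by_cases h : v ∈ S
  · rw [decide_eq_true h, if_pos h, pure_val]
  · rw [decide_eq_false h, if_neg h, snoc_val]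

theorem fold_addWord_val (S : List (Word A k)) (w : Word A k) :
    (fold addWord S w.inits).val = withPrefixes S w := by
  simp only [fold_val, addWord_val, withPrefixes]

theorem mem_withPrefixes {S : List (Word A k)} {s w : Word A k} :
    s ∈ withPrefixes S w ↔ s ∈ S ∨ s <+: w := by
  refine ⟨fun h => ?_, ?_⟩
  · exact (mem_or_mem_of_mem_foldl_insertNew h).imp_right (List.mem_inits s w).1
  · rintro (h | h)
    · exact (prefix_foldl_insertNew w.inits S).subset h
    · simpa [withPrefixes] using
        map_mem_foldl_insertNew (f := id) (base := S) ((List.mem_inits s w).2 h)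

theorem length_withPrefixes_le (S : List (Word A k)) (w : Word A k) :
    (withPrefixes S w).length ≤ S.length + (w.length + 1) := by
  simpa [withPrefixes] using length_foldl_insertNew_le (f := id) w.inits S

variable [Fintype A] {T : Teacher A}

theorem amend_eq (O : Table A k) (w : Word A k) : amend T O w = (do
    let S ← accessing O
    tick ((w.length + 1) * (k * w.length + 1))
    let S' ← fold addWord S w.inits
    fill T S' O.E) := rfl

theorem amend_val (S E : List (Word A k)) (w : Word A k) :
    (amend T (tableOf T S E) w).val = tableOf T (withPrefixes S w) E := by
  simp only [amend_eq, bind_val, accessing_val, fill_val, fold_addWord_val]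
  rfl

omit [DecidableEq A] in
theorem extendTable_val (c : ℕ+) (S E : List (Word A k)) :
    (extendTable T c (tableOf T S E)).val =
      tableOf T (S.map (List.map (extendLetter c))) (E.map (List.map (extendLetter c))) := by
  simp only [extendTable, bind_val, accessing_val, fill_val, map_val]
  rfl

end Amend

/-! ### The cost of an iteration -/

/-- `B` bounds the parameters of the learner for the arity `k`; the costs of all parts of an
iteration are then bounded by powers of `B`. -/
structure Dominates (A : Type) [Fintype A] (k : ℕ+) (B : ℕ) : Prop where
  four_le : 4 ≤ B
  arity_le : (k : ℕ) ≤ B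
  letters_le : (Fintype.card A + 1) ^ (k : ℕ) ≤ B
  maps_le : ((k : ℕ) + 1) ^ (k : ℕ) ≤ B

theorem Dominates.two_le {A : Type} [Fintype A] {k : ℕ+} {B : ℕ} (h : Dominates A k B) : 2 ≤ B := by
  have := h.four_le
  omega

/-- The numbers and lengths of accessing and separating sequences are at most `X`. -/
structure Sized {A : Type} {k : ℕ+} (S E : List (Word A k)) (X : ℕ) : Prop where
  length_S : S.length ≤ X
  length_E : E.length ≤ X
  word_S : ∀ s ∈ S, s.length ≤ X
  word_E : ∀ e ∈ E, e.length ≤ X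

namespace Sized

variable {A : Type} {k : ℕ+} {S E : List (Word A k)} {X Y : ℕ}

theorem mono (h : Sized S E X) (hXY : X ≤ Y) : Sized S E Y :=
  ⟨h.length_S.trans hXY, h.length_E.trans hXY, fun s hs => (h.word_S s hs).trans hXY,
    fun e he => (h.word_E e he).trans hXY⟩

theorem extend (h : Sized S E X) (c : ℕ+) :
    Sized (S.map (List.map (extendLetter c))) (E.map (List.map (extendLetter c))) X :=
  ⟨by simpa using h.length_S, by simpa using h.length_E, by simpa using h.word_S,
    by simpa using h.word_E⟩

theorem amend [DecidableEq A] (h : Sized S E X) (w : Word A k) :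
    Sized (withPrefixes S w) E (X + w.length + 1) where
  length_S := by
    have := length_withPrefixes_le S w
    have := h.length_S
    omega
  length_E := h.length_E.trans (by omega)
  word_S s hs := by
    rcases mem_withPrefixes.1 hs with hs | hs
    · have := h.word_S s hs
      omega
    · have := hs.length_le
      omega
  word_E e he := (h.word_E e he).trans (by omega)

end Sized

section Costs

variable {A : Type} {k : ℕ+} {B : ℕ}

theorem eqRow_time_le (hB : 2 ≤ B) {r r' : List Bool} (h : r.length ≤ B) (h' : r'.length ≤ B) :
    (eqRow r r').time ≤ B ^ 4 :=
  add_le_pow hB (add_le_pow hB (le_pow_one h) (le_pow_one h')) one_le_pow_zero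

theorem addEntry_time_le (hB : 2 ≤ B) {x₀ x : Entry A k} {xs : List (Entry A k)}
    (hx : x.row.length ≤ B) (hrow : ∀ y ∈ x₀ :: xs, y.row.length ≤ B) (hxs : xs.length ≤ B) :
    (addEntry x₀ xs x).time ≤ B ^ 11 := by
  have hlen : xs.length + 1 ≤ B ^ 2 := add_le_pow hB (le_pow_one hxs) one_le_pow_zero
  have hany : (Timed.any (fun y => eqRow x.row y.row) (x₀ :: xs)).time ≤ B ^ 8 :=
    (any_time_le fun y hy => eqRow_time_le hB hx (hrow y hy)).trans
      (mul_succ_succ_le_pow hB hlen le_rfl)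
  rw [addEntry, bind_time]
  refine add_le_pow hB (b := 2) hany ?_
  split
  exacts [Nat.zero_le _, hlen]

theorem otherEntries_time_le (hB : 2 ≤ B) {O : Table A k} {x₀ : Entry A k}
    (hO : O.entries.length ≤ B) (hx₀ : x₀.row.length ≤ B)
    (hrow : ∀ x ∈ O.entries, x.row.length ≤ B) : (otherEntries O x₀).time ≤ B ^ 14 := by
  refine (fold_invariant (c := B ^ 11)
    (fun i xs => xs.length ≤ i ∧ ∀ y ∈ x₀ :: xs, y.row.length ≤ B) ?_ ?_).2.trans
    (mul_succ_succ_le_pow hB (le_pow_one hO) le_rfl)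
  · intro i xs x hx hi ⟨hlen, hxs⟩
    refine ⟨⟨?_, fun y hy => ?_⟩,
      addEntry_time_le hB (hrow x hx) hxs (hlen.trans (hi.le.trans hO))⟩
    · have hinsert := length_insertNew_le (f := Entry.row) (x₀ :: xs) x
      rw [← cons_addEntry_val, List.length_cons, List.length_cons] at hinsert
      omega
    · rw [cons_addEntry_val] at hy
      rcases mem_or_eq_of_mem_insertNew hy with hy | rfl
      exacts [hxs y hy, hrow y hx]
  · simpa using hx₀

theorem length_otherEntries_le (O : Table A k) (x₀ : Entry A k) :
    (otherEntries O x₀).val.length ≤ O.entries.length := by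
  have h := length_foldl_insertNew_le (f := Entry.row) O.entries [x₀]
  rw [← cons_otherEntries_val, List.length_cons, List.length_singleton] at h
  omega

theorem mem_otherEntries_imp {O : Table A k} {x₀ x : Entry A k}
    (hx : x ∈ x₀ :: (otherEntries O x₀).val) : x = x₀ ∨ x ∈ O.entries := by
  rw [cons_otherEntries_val] at hx
  simpa using mem_or_mem_of_mem_foldl_insertNew hx

theorem firstEntry_time_le (hB : 2 ≤ B) {O : Table A k} (hO : O.entries.length ≤ B) :
    (firstEntry O).time ≤ B ^ 3 := by
  refine (findSome_time_le (c := 1) fun x _ => ?_).trans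
    (mul_succ_succ_le_pow hB (le_pow_one hO) one_le_pow_zero)
  split <;> simp

theorem lookupStep_time_le [DecidableEq A] (hB : 2 ≤ B) (hk : (k : ℕ) ≤ B) {n : ℕ} (hn : n ≤ B)
    {state : Fin (n + 1) → Entry A k} (hrow : ∀ i, (state i).row.length ≤ B)
    (hsucc : ∀ i, (state i).succ.length ≤ B)
    (hsucc_row : ∀ i, ∀ p ∈ (state i).succ, p.2.length ≤ B) (i : Fin (n + 1)) (a : Fin k → A) :
    (lookupStep state i a).time ≤ B ^ 16 := by
  have hfound : (((state i).succ.findSome? fun p =>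
      if p.1 = a then some p.2 else none).getD []).length ≤ B := by
    cases h : (state i).succ.findSome? fun p => if p.1 = a then some p.2 else none with
    | none => simp
    | some r =>
      obtain ⟨p, hp, h⟩ := List.exists_of_findSome?_eq_some h
      split_ifs at h
      exact Option.some.inj h ▸ hsucc_row i p hp
  simp only [lookupStep, bind_time, bind_val, pure_val, tick_time, pure_time, add_zero,
    findSome_val]
  refine le_pow_of_le hB (add_le_pow hB (a := 5) ?_
    (add_le_pow hB (a := 8) ?_ (le_pow_one hk))) (by norm_num)
  · exact (findSome_time_le (c := 2 * k) fun p _ => by simp).trans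
      (mul_succ_succ_le_pow hB (le_pow_one (hsucc i))
        (mul_le_pow (le_pow_one hB) (le_pow_one hk)))
  · refine (findSome_time_le (c := B ^ 4) fun j _ => ?_).trans (mul_succ_succ_le_pow hB
      (by simpa using add_le_pow hB (le_pow_one hn) one_le_pow_zero) le_rfl)
    rw [bind_time]
    refine le_trans (le_of_eq ?_) (eqRow_time_le hB hfound (hrow j))
    split <;> rfl

end Costs

section TableCosts

variable {A : Type} [Fintype A] {k : ℕ+} {T : Teacher A} {S E : List (Word A k)} {B : ℕ}

theorem length_row_of_mem {x : Entry A k} (hx : x ∈ (tableOf T S E).entries) :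
    x.row.length = E.length := by
  obtain ⟨s, -, rfl⟩ := List.mem_map.1 hx
  simp [entryOf, rowOf]

theorem length_word_le_of_mem (h : Sized S E B) {x : Entry A k}
    (hx : x ∈ (tableOf T S E).entries) : x.word.length ≤ B := by
  obtain ⟨s, hs, rfl⟩ := List.mem_map.1 hx
  exact h.word_S s hs

theorem length_succ_le_of_mem (hB : Dominates A k B) {x : Entry A k}
    (hx : x ∈ (tableOf T S E).entries) : x.succ.length ≤ B := by
  obtain ⟨s, -, rfl⟩ := List.mem_map.1 hx
  simpa [entryOf] using length_letters_le hB.letters_le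

theorem length_of_mem_succ {x : Entry A k} (hx : x ∈ (tableOf T S E).entries)
    {p : (Fin k → A) × List Bool} (hp : p ∈ x.succ) : p.2.length = E.length := by
  obtain ⟨s, -, rfl⟩ := List.mem_map.1 hx
  obtain ⟨a, -, rfl⟩ := List.mem_map.1 hp
  simp [rowOf]

theorem length_entries_le (h : Sized S E B) : (tableOf T S E).entries.length ≤ B := by
  simpa [tableOf] using h.length_S

theorem entryOf_mem_entries {s : Word A k} (hs : s ∈ S) :
    entryOf T E s ∈ (tableOf T S E).entries :=
  List.mem_map_of_mem hs

theorem concat_time_le (hB : Dominates A k B) {w w' : Word A k} (h : w.length ≤ B)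
    (h' : w'.length ≤ B) : (concat w w').time ≤ B ^ 5 :=
  add_le_pow hB.two_le (mul_le_pow (le_pow_one hB.arity_le)
    (add_le_pow hB.two_le (le_pow_one h) (le_pow_one h'))) one_le_pow_zero

theorem askRow_time_le (hB : Dominates A k B) (h : Sized S E B) {w : Word A k}
    (hw : w.length ≤ B ^ 2) : (askRow T E w).time ≤ B ^ 16 := by
  have hB2 := hB.two_le
  refine le_pow_of_le hB2 ((map_time_le (c := B ^ 13) fun e he => ?_).trans
    (mul_succ_succ_le_pow hB2 (le_pow_one h.length_E) le_rfl)) (by norm_num)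
  have hwe : k * (w.length + e.length) + 1 ≤ B ^ 6 := le_pow_of_le hB2
    (add_le_pow hB2 (mul_le_pow (le_pow_one hB.arity_le)
      (add_le_pow hB2 hw (le_pow_one (h.word_E e he)))) one_le_pow_zero) (by norm_num)
  simp only [bind_time, concat_time, concat_val, ask_time, List.length_append]
  exact add_le_pow hB2 hwe hwe

theorem fill_time_le (hB : Dominates A k B) (h : Sized S E B) : (fill T S E).time ≤ B ^ 56 := by
  have hB2 := hB.two_le
  simp only [fill, bind_time, pure_time, add_zero]
  refine le_pow_of_le hB2 (add_le_pow hB2 (letters_time_le hB2 hB.arity_le hB.letters_le)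
    ((map_time_le (c := B ^ 41) fun s hs => ?_).trans
      (mul_succ_succ_le_pow hB2 (le_pow_one h.length_S) le_rfl))) (by norm_num)
  have hs1 : s.length ≤ B ^ 1 := le_pow_one (h.word_S s hs)
  have hs2 : s.length + 1 ≤ B ^ 2 := add_le_pow hB2 hs1 one_le_pow_zero
  refine le_pow_of_le hB2 (add_le_pow hB2
    (askRow_time_le hB h (le_pow_of_le hB2 hs1 one_le_two))
    ((map_time_le (c := B ^ 21) fun a _ => ?_).trans (mul_succ_succ_le_pow hB2
      (le_pow_one (length_letters_le hB.letters_le)) le_rfl))) (by norm_num)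
  simp only [bind_time, pure_time, add_zero, concat_time, List.length_singleton]
  exact le_pow_of_le hB2 (add_le_pow hB2
    (add_le_pow hB2 (mul_le_pow (le_pow_one hB.arity_le) hs2) one_le_pow_zero)
    (askRow_time_le hB h (by simpa using hs2))) (by norm_num)

theorem accessing_time_le (hB : 2 ≤ B) (h : Sized S E B) :
    (accessing (tableOf T S E)).time ≤ B ^ 3 :=
  (map_time_le (c := 1) fun _ _ => by simp).trans
    (mul_succ_succ_le_pow hB (le_pow_one (length_entries_le h)) one_le_pow_zero)

theorem inconsistency_time_le (hB : Dominates A k B) (h : Sized S E B) :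
    (inconsistency (tableOf T S E)).time ≤ B ^ 22 := by
  have hB2 := hB.two_le
  have hentries := le_pow_one (length_entries_le (T := T) h)
  refine (findSome_time_le (c := B ^ 19) fun x hx => ?_).trans
    (mul_succ_succ_le_pow hB2 hentries le_rfl)
  refine (findSome_time_le (c := B ^ 16) fun y hy => ?_).trans
    (mul_succ_succ_le_pow hB2 hentries le_rfl)
  rw [bind_time]
  refine add_le_pow hB2 (eqRow_time_le hB2 (length_row_of_mem hx ▸ h.length_E)
    (length_row_of_mem hy ▸ h.length_E)) (b := 11) ?_
  split
  · exact Nat.zero_le _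
  refine (findSome_time_le (c := B ^ 8) fun p _ => ?_).trans
    (mul_succ_succ_le_pow hB2 (le_pow_one ?_) le_rfl)
  · refine (findSome_time_le (c := B ^ 5) fun q hq => ?_).trans
      (mul_succ_succ_le_pow hB2 (le_pow_one ?_) le_rfl)
    · split
      · exact Nat.zero_le _
      · exact concat_time_le hB (by simpa using hB2.trans' one_le_two)
          (h.word_E _ (List.of_mem_zip hq).1)
    · exact List.length_zip.trans_le ((min_le_left _ _).trans h.length_E)
  · exact List.length_zip.trans_le ((min_le_left _ _).trans (length_succ_le_of_mem hB hx))

theorem unclosed_time_le (hB : Dominates A k B) (h : Sized S E B) :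
    (unclosed (tableOf T S E)).time ≤ B ^ 19 := by
  have hB2 := hB.two_le
  have hentries := le_pow_one (length_entries_le (T := T) h)
  refine (findSome_time_le (c := B ^ 16) fun x hx => ?_).trans
    (mul_succ_succ_le_pow hB2 hentries le_rfl)
  refine (findSome_time_le (c := B ^ 13) fun p hp => ?_).trans
    (mul_succ_succ_le_pow hB2 (le_pow_one (length_succ_le_of_mem hB hx)) le_rfl)
  rw [bind_time]
  refine add_le_pow hB2 (a := 7) (b := 5) ?_ ?_
  · exact (any_time_le fun y hy => eqRow_time_le hB2 (length_of_mem_succ hx hp ▸ h.length_E)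
      (length_row_of_mem hy ▸ h.length_E)).trans (mul_succ_succ_le_pow hB2 hentries le_rfl)
  · split
    · exact Nat.zero_le _
    · exact concat_time_le hB (length_word_le_of_mem h hx) (by simpa using hB2.trans' one_le_two)

variable [DecidableEq A]

theorem conjectureOf_time_le (hB : Dominates A k B) (h : Sized S E B) {x₀ : Entry A k}
    {others : List (Entry A k)} (hmem : ∀ x ∈ x₀ :: others, x ∈ (tableOf T S E).entries)
    (hlen : others.length ≤ B) : (conjectureOf x₀ others).time ≤ B ^ 35 := by
  have hB2 := hB.two_le
  have hlen1 : others.length + 1 ≤ B ^ 2 := add_le_pow hB2 (le_pow_one hlen) one_le_pow_zero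
  have hstates : Fintype.card (Fin (others.length + 1)) ≤ B ^ 2 := by simpa using hlen1
  have hletters : Fintype.card (Fin k → A) ≤ B ^ 1 := by
    rw [Fintype.card_fun, Fintype.card_fin, pow_one, ← length_letters]
    exact length_letters_le hB.letters_le
  have hstate (i) : (x₀ :: others).get i ∈ (tableOf T S E).entries := hmem _ (List.get_mem _ _)
  have hstep (i a) : (lookupStep (x₀ :: others).get i a).time ≤ B ^ 16 :=
    lookupStep_time_le hB2 hB.arity_le hlen
      (fun i => length_row_of_mem (hstate i) ▸ h.length_E)
      (fun i => length_succ_le_of_mem hB (hstate i))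
      (fun i p hp => length_of_mem_succ (hstate i) hp ▸ h.length_E) i a
  simp only [conjectureOf, bind_time, tick_time, pure_time, add_zero]
  exact le_pow_of_le hB2 (add_le_pow hB2 hlen1 (add_le_pow hB2
    ((tabulate_time_le fun i => (tabulate_time_le (hstep i)).trans
      (mul_le_pow hletters (add_le_pow hB2 le_rfl one_le_pow_zero))).trans
      (mul_le_pow hstates (add_le_pow hB2 le_rfl one_le_pow_zero)))
    ((tabulate_time_le (c := 1) fun i => by simp).trans
      (mul_le_pow hstates (add_le_pow hB2 one_le_pow_zero one_le_pow_zero))))) (by norm_num)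

theorem conjecture_time_le (hB : Dominates A k B) (h : Sized S E B) (h0 : [] ∈ S) :
    (conjecture (tableOf T S E)).time ≤ B ^ 54 := by
  have hB2 := hB.two_le
  have hentries := length_entries_le (T := T) h
  have hrow (x) (hx : x ∈ (tableOf T S E).entries) : x.row.length ≤ B :=
    length_row_of_mem hx ▸ h.length_E
  have hfirst := entryOf_mem_entries (T := T) (E := E) h0
  simp only [conjecture_eq, bind_time]
  rw [firstEntry_val h0]
  refine add_le_pow hB2 (firstEntry_time_le hB2 hentries)
    (add_le_pow hB2 (otherEntries_time_le hB2 hentries (hrow _ hfirst) hrow)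
      (conjectureOf_time_le (T := T) hB h ?_ ((length_otherEntries_le _ _).trans hentries)))
  intro x hx
  rcases mem_otherEntries_imp hx with rfl | hx
  exacts [hfirst, hx]

theorem addWord_time_le (hB : Dominates A k B) {v : Word A k} (hv : v.length ≤ B)
    (hS : S.length + 1 ≤ B) (hword : ∀ s ∈ S, s.length ≤ B) : (addWord S v).time ≤ B ^ 10 := by
  have hB2 := hB.two_le
  have hany : (Timed.any (fun s => eqWord s v) S).time ≤ B ^ 8 :=
    (any_time_le fun s hs => concat_time_le hB (hword s hs) hv).trans
      (mul_succ_succ_le_pow hB2 (le_pow_one (by omega)) le_rfl)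
  rw [addWord, bind_time]
  refine add_le_pow hB2 (b := 1) hany ?_
  split
  exacts [Nat.zero_le _, le_pow_one hS]

theorem fold_addWord_time_le (hB : Dominates A k B) {w : Word A k}
    (hw : S.length + (w.length + 1) ≤ B) (hword : ∀ s ∈ S, s.length ≤ B) :
    (fold addWord S w.inits).time ≤ B ^ 13 := by
  refine (fold_invariant (c := B ^ 10)
    (fun i S' => S'.length ≤ S.length + i ∧ ∀ s ∈ S', s.length ≤ B) ?_ ⟨le_rfl, hword⟩).2.trans
    (mul_succ_succ_le_pow hB.two_le (le_pow_one ?_) le_rfl)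
  · intro i S' v hv hi ⟨hlen, hS'⟩
    rw [List.length_inits] at hi
    have hvB : v.length ≤ B := ((List.mem_inits v w).1 hv).length_le.trans (by omega)
    refine ⟨?_, addWord_time_le hB hvB (by omega) hS'⟩
    rw [addWord_val]
    refine ⟨(length_insertNew_le S' v).trans (by omega), fun s hs => ?_⟩
    rcases mem_or_eq_of_mem_insertNew hs with hs | rfl
    exacts [hS' s hs, hvB]
  · rw [List.length_inits]
    omega

theorem amend_time_le (hB : Dominates A k B) {X : ℕ} (h : Sized S E X) {w : Word A k}
    (hX : X + w.length + 1 ≤ B) : (amend T (tableOf T S E) w).time ≤ B ^ 90 := by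
  have hB2 := hB.two_le
  have hSB : Sized S E B := h.mono (by omega)
  have hw : w.length ≤ B ^ 1 := le_pow_one (by omega)
  have hlen := h.length_S
  have hfill := fill_time_le (T := T) hB ((h.amend w).mono hX)
  simp only [amend_eq, bind_time, accessing_val, tick_time, fold_addWord_val]
  exact le_pow_of_le hB2 (add_le_pow hB2 (accessing_time_le hB2 hSB) (add_le_pow hB2
    (mul_le_pow (add_le_pow hB2 hw one_le_pow_zero)
      (add_le_pow hB2 (mul_le_pow (le_pow_one hB.arity_le) hw) one_le_pow_zero))
    (add_le_pow hB2 (fold_addWord_time_le hB (by omega) hSB.word_S) hfill))) (by norm_num)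

omit [DecidableEq A] in
theorem extend_time_le {c : ℕ+} (hB : Dominates A c B) {w : Word A k} (hw : w.length ≤ B) :
    (extend c w).time ≤ B ^ 3 :=
  add_le_pow hB.two_le (mul_le_pow (le_pow_one hB.arity_le) (le_pow_one hw)) one_le_pow_zero

omit [DecidableEq A] in
theorem extendTable_time_le {c : ℕ+} (hB : Dominates A c B) (h : Sized S E B) :
    (extendTable T c (tableOf T S E)).time ≤ B ^ 90 := by
  have hB2 := hB.two_le
  have hwords {L : List (Word A k)} (hL : L.length ≤ B) (hword : ∀ s ∈ L, s.length ≤ B) :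
      (Timed.map (HyperLearn.extend c) L).time ≤ B ^ 6 :=
    (map_time_le fun s hs => extend_time_le hB (hword s hs)).trans
      (mul_succ_succ_le_pow hB2 (le_pow_one hL) le_rfl)
  have hfill := fill_time_le (T := T) hB (h.extend c)
  simp only [extendTable, bind_time, accessing_val, map_val]
  exact le_pow_of_le hB2 (add_le_pow hB2 (accessing_time_le hB2 h) (add_le_pow hB2
    (hwords h.length_S h.word_S) (add_le_pow hB2 (hwords h.length_E h.word_E) hfill)))
    (by norm_num)

end TableCosts

/-! ### Rows and conjectures -/

section Rows

variable {A : Type} {k : ℕ+} {T : Teacher A} {S E : List (Word A k)}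

/-- The membership answers of the teacher are right for `H`, over every arity. -/
def AnswersMembership (T : Teacher A) (H : Hyperproperty A) : Prop :=
  ∀ (k : ℕ+) (w : Word A k), T.member k w = true ↔ w ∈ badWords H k

/-- The number of different rows of accessing sequences. -/
def rowCount (T : Teacher A) (S E : List (Word A k)) : ℕ := (S.map (rowOf T E)).toFinset.card

theorem rowCount_mono {S' : List (Word A k)} (h : S ⊆ S') : rowCount T S E ≤ rowCount T S' E :=
  Finset.card_le_card fun _ hr =>
    List.mem_toFinset.2 (List.map_subset _ h (List.mem_toFinset.1 hr))

theorem rowCount_lt_of_new_row {v : Word A k} (h : ∀ t ∈ S, rowOf T E v ≠ rowOf T E t) :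
    rowCount T S E < rowCount T (S ++ [v]) E := by
  have hv : rowOf T E v ∉ (S.map (rowOf T E)).toFinset := by
    simpa only [List.mem_toFinset, List.mem_map, not_exists, not_and] using
      fun t ht => (h t ht).symm
  have hinsert : ((S ++ [v]).map (rowOf T E)).toFinset =
      insert (rowOf T E v) (S.map (rowOf T E)).toFinset := by
    ext r
    simp only [List.map_append, List.map_singleton, List.toFinset_append, Finset.mem_union,
      Finset.mem_insert, List.mem_toFinset, List.mem_singleton, or_comm]
  rw [rowCount, rowCount, hinsert, Finset.card_insert_of_notMem hv]
  exact Nat.lt_succ_self _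

theorem rowOf_concat (v w : Word A k) :
    rowOf T (E ++ [v]) w = rowOf T E w ++ [T.member k (w ++ v)] := by
  simp [rowOf]

theorem rowCount_lt_of_new_column {v s t : Word A k} (hs : s ∈ S) (ht : t ∈ S)
    (hst : rowOf T E s = rowOf T E t) (hne : T.member k (s ++ v) ≠ T.member k (t ++ v)) :
    rowCount T S E < rowCount T S (E ++ [v]) := by
  have hmem {w} (hw : w ∈ S) :
      rowOf T (E ++ [v]) w ∈ (S.map (rowOf T (E ++ [v]))).toFinset :=
    List.mem_toFinset.2 (List.mem_map_of_mem hw)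
  have himg : (S.map (rowOf T E)).toFinset =
      (S.map (rowOf T (E ++ [v]))).toFinset.image List.dropLast := by
    ext r
    simp [rowOf_concat]
  rw [rowCount, himg]
  refine lt_of_le_of_ne Finset.card_image_le fun heq => hne ?_
  have hrow := Finset.card_image_iff.1 heq (hmem hs) (hmem ht) (by simp [rowOf_concat, hst])
  rw [rowOf_concat, rowOf_concat, hst] at hrow
  simpa using hrow

theorem rowCount_le_card_states {H : Hyperproperty A} (hT : AnswersMembership T H) {κ : ℕ+}
    (hk : k ≤ κ) {Q : Type*} [Fintype Q] {D : DFA (Fin κ → A) Q} (hD : D.accepts = badWords H κ) :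
    rowCount T S E ≤ Fintype.card Q := by
  classical
  let rowOfState (q : Q) : List Bool :=
    E.map fun e => decide (D.evalFrom q (e.map (extendLetter κ)) ∈ D.accept)
  have hrow (w : Word A k) : rowOf T E w = rowOfState (D.eval (w.map (extendLetter κ))) := by
    refine List.map_congr_left fun e _ => ?_
    rw [Bool.eq_iff_iff, hT, decide_eq_true_iff, ← map_extendLetter_mem_badWords_iff hk,
      ← hD, List.map_append, DFA.mem_accepts, DFA.eval, DFA.evalFrom_of_append]
  have hsub : (S.map (rowOf T E)).toFinset ⊆ Finset.univ.image rowOfState := by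
    intro r hr
    obtain ⟨s, -, rfl⟩ := List.mem_map.1 (List.mem_toFinset.1 hr)
    exact Finset.mem_image.2 ⟨_, Finset.mem_univ _, (hrow s).symm⟩
  exact (Finset.card_le_card hsub).trans Finset.card_image_le

theorem headD_rowOf (hE : E.head? = some []) (w : Word A k) :
    (rowOf T E w).headD false = T.member k w := by
  obtain ⟨E', rfl⟩ := List.head?_eq_some_iff.1 hE
  simp [rowOf]

end Rows

namespace IsConjecture

variable {A : Type} {k : ℕ+} {T : Teacher A} {S E : List (Word A k)} {M : Conjecture A k}
  {σ : Fin M.size → Word A k}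

theorem size_le (h : IsConjecture T S E M σ) : M.size ≤ rowCount T S E := by
  rw [← Fintype.card_fin M.size, ← Finset.card_univ,
    ← Finset.card_image_of_injective _ h.injective]
  refine Finset.card_le_card fun r hr => ?_
  obtain ⟨i, -, rfl⟩ := Finset.mem_image.1 hr
  exact List.mem_toFinset.2 (List.mem_map_of_mem (h.mem i))

theorem accept_eq (h : IsConjecture T S E M σ) (hE : E.head? = some []) (i : Fin M.size) :
    M.accept i = T.member k (σ i) := by
  rw [h.accept, headD_rowOf hE]

theorem accept_step (h : IsConjecture T S E M σ) (hE : E.head? = some [])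
    (i : Fin M.size) (a : Fin k → A) : M.accept (M.step i a) = T.member k (σ i ++ [a]) := by
  rw [h.accept, h.step, headD_rowOf hE]

theorem row_eval (h : IsConjecture T S E M σ) {S' : List (Word A k)} (hS : S ⊆ S')
    (hcons : Consistent T S' E) {w : Word A k} (hw : ∀ v, v <+: w → v ∈ S') :
    rowOf T E w = rowOf T E (σ (M.toDFA.eval w)) := by
  induction w using List.reverseRecOn with
  | nil => exact h.start.symm
  | append_singleton w a ih =>
    have ih := ih fun v hv => hw v (hv.trans (List.prefix_append _ _))
    rw [hcons w (hw w (List.prefix_append _ _)) _ (hS (h.mem _)) ih a, DFA.eval_append_singleton]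
    exact (h.step _ _).symm

variable {H : Hyperproperty A}

theorem not_consistent_withPrefixes [DecidableEq A] (h : IsConjecture T S E M σ)
    (hE : E.head? = some []) (hT : AnswersMembership T H) {w : Word A k}
    (hw : ¬ (w ∈ M.toDFA.accepts ↔ w ∈ badWords H k)) :
    ¬ Consistent T (withPrefixes S w) E := by
  refine fun hcons => hw ?_
  have hrow := h.row_eval (fun s hs => mem_withPrefixes.2 (.inl hs)) hcons
    (fun v hv => mem_withPrefixes.2 (.inr hv))
  rw [← hT, ← headD_rowOf (T := T) hE, hrow, ← h.accept]
  rfl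

theorem accepts_eq [Fintype A] (h : IsConjecture T S E M σ) (hE : E.head? = some [])
    (hT : AnswersMembership T H) (hrep : IsRepresentation H M.toDFA.accepts)
    (hperm : (incompleteness M).val = none) : M.toDFA.accepts = badWords H k := by
  have hmem (w) : w ∈ M.toDFA.accepts ↔ σ (M.toDFA.eval w) ∈ badWords H k := by
    rw [← hT, ← h.accept_eq hE]
    rfl
  have hsnoc (w a) : w ++ [a] ∈ M.toDFA.accepts ↔ σ (M.toDFA.eval w) ++ [a] ∈ badWords H k := by
    rw [← hT, ← h.accept_step hE, DFA.mem_accepts, DFA.eval_append_singleton]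
    rfl
  refine hrep.eq_badWords_of_closed (fun w hw a => ?_) (fun w hw => ?_)
    fun _ _ => mem_accepts_of_permute_of_incompleteness hperm
  · exact (hsnoc w a).2 (append_mem_badWords ((hmem w).1 hw) [a])
  · obtain ⟨a, ha⟩ := exists_snoc_notMem_badWords (mt (hmem w).2 hw)
    exact ⟨a, mt (hsnoc w a).1 ha⟩

end IsConjecture

section Counterexamples

variable {A : Type} {k c : ℕ+}

theorem map_extendLetter_self (w : Word A k) : w.map (extendLetter k) = w := by
  have h : (extendLetter k : (Fin k → A) → Fin k → A) = id := by
    funext v i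
    have hi : min (i : ℕ) (k - 1) = i := by omega
    simp [extendLetter, hi]
  rw [h, List.map_id]

theorem IsCounterexample.misclassified {H : Hyperproperty A} {n : ℕ}
    {M : DFA (Fin k → A) (Fin n)} {w : Word A c} (h : IsCounterexample H M c w) (hc : c ≤ k) :
    ¬ (w.map (extendLetter k) ∈ M.accepts ↔ w.map (extendLetter k) ∈ badWords H k) := by
  cases h with
  | missed _ hw h =>
    exact fun hiff => h _ (unzip_map_extendLetter hc w)
      (hiff.2 ((map_extendLetter_mem_badWords_iff hc).2 hw))
  | spurious w hw h =>
    rw [map_extendLetter_self]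
    exact fun hiff => h (hiff.1 hw)

end Counterexamples

section Potential

variable {A : Type} {k κ : ℕ+} {T : Teacher A} {S E : List (Word A k)} {N : ℕ}

open Classical in
/-- A bound for the number of further iterations, for the target arity `κ` and at most `N` different
rows: every iteration raises the arity, or finds a new row, or makes a consistent table
inconsistent. -/
noncomputable def potential (T : Teacher A) (κ : ℕ+) (N : ℕ) (S E : List (Word A k)) : ℕ :=
  2 * (((κ : ℕ) - k) * (N + 1) + (N - rowCount T S E)) + if Consistent T S E then 1 else 0

theorem potential_lt_of_rowCount_lt {S' E' : List (Word A k)}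
    (h : rowCount T S E < rowCount T S' E') (hN : rowCount T S' E' ≤ N) :
    potential T κ N S' E' < potential T κ N S E := by
  unfold potential
  split_ifs <;> omega

theorem potential_lt_of_not_consistent {S' : List (Word A k)} (h : S ⊆ S')
    (hc : Consistent T S E) (hc' : ¬ Consistent T S' E) :
    potential T κ N S' E < potential T κ N S E := by
  have := rowCount_mono (T := T) (E := E) h
  unfold potential
  rw [if_pos hc, if_neg hc']
  omega

theorem potential_lt_of_arity_lt {c : ℕ+} {S' E' : List (Word A c)} (hkc : k < c)
    (hc : c ≤ κ) : potential T κ N S' E' < potential T κ N S E := by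
  have hkc : (k : ℕ) < c := hkc
  have hc : (c : ℕ) ≤ κ := hc
  have harity : ((κ : ℕ) - c) * (N + 1) + (N + 1) ≤ (κ - k) * (N + 1) := by
    rw [← Nat.succ_mul]
    exact Nat.mul_le_mul_right _ (by omega)
  unfold potential
  split_ifs <;> omega

theorem potential_le : potential T κ N S E ≤ 2 * (κ * (N + 1) + N) + 1 := by
  have : ((κ : ℕ) - k) * (N + 1) ≤ κ * (N + 1) := Nat.mul_le_mul_right _ (Nat.sub_le _ _)
  unfold potential
  split_ifs <;> omega

end Potential

theorem Dominates.mono {A : Type} [Fintype A] {B : ℕ} {k κ : ℕ+} (h : Dominates A κ B)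
    (hk : k ≤ κ) : Dominates A k B where
  four_le := h.four_le
  arity_le := le_trans hk h.arity_le
  letters_le := (Nat.pow_le_pow_right (Nat.succ_pos _) hk).trans h.letters_le
  maps_le := (Nat.pow_le_pow_left (Nat.succ_le_succ hk) _).trans
    ((Nat.pow_le_pow_right (Nat.succ_pos _) hk).trans h.maps_le)

/-! ### Iterations -/

/-- The learner can go on from the table with accessing sequences `S` and separating sequences
`E`, whose sizes are bounded by `X`. -/
structure Admissible {A : Type} {k : ℕ+} (S E : List (Word A k)) (X : ℕ) : Prop
    extends Sized S E X where
  nil_mem : [] ∈ S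
  head_eq : E.head? = some []

namespace Admissible

variable {A : Type} {k : ℕ+} {S E : List (Word A k)} {X Y : ℕ}

theorem mono (h : Admissible S E X) (hXY : X ≤ Y) : Admissible S E Y :=
  ⟨h.toSized.mono hXY, h.nil_mem, h.head_eq⟩

theorem concat_accessing (h : Admissible S E X) {s : Word A k} (hs : s ∈ S) (a : Fin k → A) :
    Admissible (S ++ [s ++ [a]]) E (X + 1) where
  length_S := by simpa using h.length_S
  length_E := h.length_E.trans (by omega)
  word_S t ht := by
    rcases List.mem_append.1 ht with ht | ht
    · exact (h.word_S t ht).trans (by omega)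
    · rw [List.mem_singleton.1 ht, List.length_append]
      exact Nat.succ_le_succ (h.word_S s hs)
  word_E e he := (h.word_E e he).trans (by omega)
  nil_mem := List.mem_append_left _ h.nil_mem
  head_eq := h.head_eq

theorem concat_separating (h : Admissible S E X) {e : Word A k} (he : e ∈ E) (a : Fin k → A) :
    Admissible S (E ++ [a :: e]) (X + 1) where
  length_S := h.length_S.trans (by omega)
  length_E := by simpa using h.length_E
  word_S s hs := (h.word_S s hs).trans (by omega)
  word_E d hd := by
    rcases List.mem_append.1 hd with hd | hd
    · exact (h.word_E d hd).trans (by omega)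
    · rw [List.mem_singleton.1 hd, List.length_cons]
      exact Nat.succ_le_succ (h.word_E e he)
  nil_mem := h.nil_mem
  head_eq := by simp [h.head_eq]

theorem amend [DecidableEq A] (h : Admissible S E X) (w : Word A k) :
    Admissible (withPrefixes S w) E (X + w.length + 1) :=
  ⟨h.toSized.amend w, mem_withPrefixes.2 (.inl h.nil_mem), h.head_eq⟩

theorem extend (h : Admissible S E X) (c : ℕ+) :
    Admissible (S.map (List.map (extendLetter c))) (E.map (List.map (extendLetter c))) X :=
  ⟨h.toSized.extend c, List.mem_map.2 ⟨[], h.nil_mem, rfl⟩, by simp [h.head_eq]⟩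

end Admissible

section QueryTime

variable {A : Type} [Fintype A] {k : ℕ+}

theorem tick_query_le {B : ℕ} (hB : Dominates A k B) {n : ℕ} (hn : n ≤ B) :
    n * Fintype.card A ^ (k : ℕ) * (k + 1) + n + 1 ≤ B ^ 7 := by
  have hB2 := hB.two_le
  have hletters : Fintype.card A ^ (k : ℕ) ≤ B :=
    length_letters.symm.trans_le (length_letters_le hB.letters_le)
  exact le_pow_of_le hB2 (add_le_pow hB2 (add_le_pow hB2
    (mul_le_pow (mul_le_pow (le_pow_one hn) (le_pow_one hletters))
      (add_le_pow hB2 (le_pow_one hB.arity_le) one_le_pow_zero)) (le_pow_one hn)) one_le_pow_zero)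
    (by norm_num)

theorem Dominates.incompleteness_time_le {B : ℕ} (hB : Dominates A k B)
    {M : Conjecture A k} (hM : M.size ≤ B) : (incompleteness M).time ≤ B ^ 60 :=
  HyperLearn.incompleteness_time_le hB.four_le hB.arity_le hB.letters_le hB.maps_le hM

end QueryTime

section Iterations

variable {A : Type} [Fintype A]

/-- The time `t` is at most the `p`th power of every number that dominates the arity `κ` and is at
least `Y`. -/
def TimeBounded (A : Type) [Fintype A] (κ : ℕ+) (Y p t : ℕ) : Prop :=
  ∀ B, Dominates A κ B → Y ≤ B → t ≤ B ^ p

/-- The computation stops with an automaton of arity `κ` that accepts all representations of bad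
prefixes and has at most `N` states. The sizes of the table it started with are at most `X`. -/
def Stops (H : Hyperproperty A) (κ : ℕ+) (N X p : ℕ) (x : Timed (Outcome A)) : Prop :=
  ∃ M : Conjecture A κ, x.val = .done κ M ∧ M.toDFA.accepts = badWords H κ ∧ M.size ≤ N ∧
    TimeBounded A κ (X + N * N + 1) p x.time

/-- The computation leads to a table with potential less than `φ`, having obtained a counterexample
of length `l`. The sizes of the table it started with are at most `X`. -/
def Progresses (T : Teacher A) (κ : ℕ+) (N φ X p : ℕ) (x : Timed (Outcome A)) : Prop :=
  ∃ (c : ℕ+) (S E : List (Word A c)) (l : ℕ), x.val = .next c (tableOf T S E) l ∧ c ≤ κ ∧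
    Admissible S E (X + l + N * N + 1) ∧ potential T κ N S E < φ ∧
      TimeBounded A κ (X + l + N * N + 1) p x.time

omit [Fintype A] in
/-- At most `N` different rows occur in any table over an arity of at most `κ`. -/
def RowsBounded (T : Teacher A) (κ : ℕ+) (N : ℕ) : Prop :=
  ∀ ⦃k : ℕ+⦄, k ≤ κ → ∀ S E : List (Word A k), rowCount T S E ≤ N

variable [DecidableEq A] {T : Teacher A} {H : Hyperproperty A} {k κ : ℕ+}
  {S E : List (Word A k)} {N X : ℕ}

theorem progresses_of_inconsistency (hN : RowsBounded T κ N) (hk : k ≤ κ)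
    (hO : Admissible S E X) {v : Word A k} (h : (inconsistency (tableOf T S E)).val = some v) :
    Progresses T κ N (potential T κ N S E) X 400 (iteration T (tableOf T S E)) := by
  obtain ⟨s, hs, t, ht, a, e, he, rfl, hst, hne⟩ := exists_of_inconsistency h
  have hO' := hO.concat_separating he a
  refine ⟨k, S, E ++ [a :: e], 0, ?_, hk, hO'.mono (by omega), ?_, fun B hB hXB => ?_⟩
  · simp only [iteration, bind_val, h, accessing_val, snoc_val, fill_val]
    rfl
  · exact potential_lt_of_rowCount_lt (rowCount_lt_of_new_column hs ht hst hne) (hN hk _ _)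
  · have hB := hB.mono hk
    have hB2 := hB.two_le
    have hSB := hO.toSized.mono (by omega : X ≤ B)
    have hsnoc : E.length + 1 ≤ B := Nat.succ_le_of_lt (hO.length_E.trans_lt (by omega))
    have hfill := fill_time_le (T := T) hB (hO'.toSized.mono (by omega))
    simp only [iteration, bind_time, h, accessing_val, snoc_val, snoc_time, pure_time, add_zero]
    exact le_pow_of_le hB2 (add_le_pow hB2 (inconsistency_time_le hB hSB) (add_le_pow hB2
      (accessing_time_le hB2 hSB) (add_le_pow hB2 (le_pow_one hsnoc) hfill))) (by norm_num)

theorem progresses_of_unclosed (hN : RowsBounded T κ N) (hk : k ≤ κ) (hO : Admissible S E X)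
    {v : Word A k} (hcons : (inconsistency (tableOf T S E)).val = none)
    (h : (unclosed (tableOf T S E)).val = some v) :
    Progresses T κ N (potential T κ N S E) X 400 (iteration T (tableOf T S E)) := by
  obtain ⟨s, hs, a, rfl, hne⟩ := exists_of_unclosed h
  have hO' := hO.concat_accessing hs a
  refine ⟨k, S ++ [s ++ [a]], E, 0, ?_, hk, hO'.mono (by omega), ?_, fun B hB hXB => ?_⟩
  · simp only [iteration, bind_val, hcons, h, accessing_val, snoc_val, fill_val]
    rfl
  · exact potential_lt_of_rowCount_lt (rowCount_lt_of_new_row hne) (hN hk _ _)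
  · have hB := hB.mono hk
    have hB2 := hB.two_le
    have hSB := hO.toSized.mono (by omega : X ≤ B)
    have hsnoc : S.length + 1 ≤ B := Nat.succ_le_of_lt (hO.length_S.trans_lt (by omega))
    have hfill := fill_time_le (T := T) hB (hO'.toSized.mono (by omega))
    simp only [iteration, bind_time, hcons, h, accessing_val, snoc_val, snoc_time, pure_time,
      add_zero]
    exact le_pow_of_le hB2 (add_le_pow hB2 (inconsistency_time_le hB hSB) (add_le_pow hB2
      (unclosed_time_le hB hSB) (add_le_pow hB2 (accessing_time_le hB2 hSB)
        (add_le_pow hB2 (le_pow_one hsnoc) hfill)))) (by norm_num)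

/-- The part of an iteration that follows the construction of the conjecture `M`. -/
noncomputable def query (T : Teacher A) (O : Table A k) (M : Conjecture A k) :
    Timed (Outcome A) := do
  tick (M.size * Fintype.card A ^ (k : ℕ) * (k + 1) + M.size + 1)
  match T.equiv k M.size M.toDFA with
  | some ⟨c, w⟩ =>
    tick (c * w.length + 1)
    if c ≤ k then
      let w' ← extend k w
      let O' ← amend T O w'
      return .next k O' w.length
    else
      let O₁ ← extendTable T c O
      let O₂ ← amend T O₁ w
      return .next c O₂ w.length
  | none =>
    match ← incompleteness M with
    | some w =>
      let O' ← amend T O w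
      return .next k O' 0
    | none => return .done k M

theorem iteration_val_eq_query {O : Table A k} (hcons : (inconsistency O).val = none)
    (hcl : (unclosed O).val = none) :
    (iteration T O).val = (query T O (conjecture O).val).val := by
  simp only [iteration, bind_val, hcons, hcl]
  rfl

theorem iteration_time_eq_query {O : Table A k} (hcons : (inconsistency O).val = none)
    (hcl : (unclosed O).val = none) :
    (iteration T O).time = (inconsistency O).time + ((unclosed O).time +
      ((conjecture O).time + (query T O (conjecture O).val).time)) := by
  simp only [iteration, bind_time, hcons, hcl]
  rfl

theorem TimeBounded.iteration_of_query (hO : Admissible S E X) (hk : k ≤ κ)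
    (hcons : (inconsistency (tableOf T S E)).val = none)
    (hcl : (unclosed (tableOf T S E)).val = none) {Y : ℕ} (hXY : X ≤ Y)
    (hq : TimeBounded A κ Y 290
      (query T (tableOf T S E) (conjecture (tableOf T S E)).val).time) :
    TimeBounded A κ Y 400 (iteration T (tableOf T S E)).time := by
  intro B hBκ hYB
  have hB := hBκ.mono hk
  have hB2 := hB.two_le
  have hSB := hO.toSized.mono (hXY.trans hYB)
  rw [iteration_time_eq_query hcons hcl]
  exact le_pow_of_le hB2 (add_le_pow hB2 (inconsistency_time_le hB hSB)
    (add_le_pow hB2 (unclosed_time_le hB hSB) (add_le_pow hB2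
      (conjecture_time_le hB hSB hO.nil_mem) (hq B hBκ hYB)))) (by norm_num)

section Query

variable {M : Conjecture A k} {σ : Fin M.size → Word A k}

omit [Fintype A] in
theorem potential_withPrefixes_lt (hM : IsConjecture T S E M σ) (hE : E.head? = some [])
    (hT : AnswersMembership T H) (hcons : Consistent T S E) {w : Word A k}
    (hw : ¬ (w ∈ M.toDFA.accepts ↔ w ∈ badWords H k)) :
    potential T κ N (withPrefixes S w) E < potential T κ N S E :=
  potential_lt_of_not_consistent (fun _ hs => mem_withPrefixes.2 (.inl hs)) hcons
    (hM.not_consistent_withPrefixes hE hT hw)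

theorem progresses_of_counterexample (hT : AnswersMembership T H) (hk : k ≤ κ)
    (hO : Admissible S E X) (hcons : Consistent T S E) (hM : IsConjecture T S E M σ)
    (hMN : M.size ≤ N) {c : ℕ+} {w : Word A c} (hq : T.equiv k M.size M.toDFA = some ⟨c, w⟩)
    (hw : IsCounterexample H M.toDFA c w) (hck : c ≤ k) :
    Progresses T κ N (potential T κ N S E) X 290 (query T (tableOf T S E) M) := by
  have hlen : (w.map (extendLetter k) : Word A k).length = w.length := List.length_map _
  refine ⟨k, withPrefixes S (w.map (extendLetter k)), E, w.length, ?_, hk,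
    (hO.amend _).mono (by omega), potential_withPrefixes_lt hM hO.head_eq hT hcons
      (hw.misclassified hck), fun B hB hXB => ?_⟩
  · simp only [query, bind_val, hq, if_pos hck]
    rw [← amend_val]
    rfl
  · have hc := (hB.mono (hck.trans hk)).arity_le
    have hB := hB.mono hk
    have hB2 := hB.two_le
    have hMB : M.size ≤ B := (hMN.trans (Nat.le_mul_self N)).trans (by omega)
    have hwB : w.length ≤ B := by omega
    have hamend := amend_time_le (T := T) hB hO.toSized (w := w.map (extendLetter k)) (by omega)
    simp only [query, bind_time, tick_time, hq, if_pos hck, pure_time, add_zero]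
    exact le_pow_of_le hB2 (add_le_pow hB2 (tick_query_le hB hMB) (add_le_pow hB2
      (add_le_pow hB2 (mul_le_pow (le_pow_one hc) (le_pow_one hwB)) one_le_pow_zero)
      (add_le_pow hB2 (extend_time_le hB hwB) hamend))) (by norm_num)

theorem progresses_of_larger_counterexample (hO : Admissible S E X) (hMN : M.size ≤ N)
    {c : ℕ+} {w : Word A c} (hq : T.equiv k M.size M.toDFA = some ⟨c, w⟩) (hck : k < c)
    (hc : c ≤ κ) :
    Progresses T κ N (potential T κ N S E) X 290 (query T (tableOf T S E) M) := by
  have hO' := hO.extend c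
  refine ⟨c, withPrefixes (S.map (List.map (extendLetter c))) w,
    E.map (List.map (extendLetter c)), w.length, ?_, hc, (hO'.amend w).mono (by omega),
    potential_lt_of_arity_lt hck hc, fun B hB hXB => ?_⟩
  · simp only [query, bind_val, hq, if_neg hck.not_ge, extendTable_val, amend_val]
    rfl
  · have hBc := hB.mono hc
    have hB := hB.mono (hck.le.trans hc)
    have hB2 := hB.two_le
    have hMB : M.size ≤ B := (hMN.trans (Nat.le_mul_self N)).trans (by omega)
    have hwB : w.length ≤ B := by omega
    have hamend := amend_time_le (T := T) hBc hO'.toSized (w := w) (by omega)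
    have hextend := extendTable_time_le (T := T) hBc (hO.toSized.mono (by omega))
    simp only [query, bind_time, tick_time, hq, if_neg hck.not_ge, pure_time, add_zero,
      extendTable_val]
    exact le_pow_of_le hB2 (add_le_pow hB2 (tick_query_le hB hMB) (add_le_pow hB2
      (add_le_pow hB2 (mul_le_pow (le_pow_one hBc.arity_le) (le_pow_one hwB)) one_le_pow_zero)
      (add_le_pow hB2 hextend hamend))) (by norm_num)

theorem progresses_of_incompleteness (hT : AnswersMembership T H) (hk : k ≤ κ)
    (hO : Admissible S E X) (hcons : Consistent T S E) (hM : IsConjecture T S E M σ)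
    (hMN : M.size ≤ N) (hq : T.equiv k M.size M.toDFA = none)
    (hbad : M.toDFA.accepts ≤ badWords H k) {w : Word A k}
    (hw : (incompleteness M).val = some w) :
    Progresses T κ N (potential T κ N S E) X 290 (query T (tableOf T S E) M) := by
  obtain ⟨f, haccept, hreject, hlen⟩ := exists_of_incompleteness hw
  have hsquare := Nat.mul_le_mul hMN hMN
  have hwbad : w ∈ badWords H k := mem_badWords_of_permute (hbad haccept)
  refine ⟨k, withPrefixes S w, E, 0, ?_, hk, (hO.amend w).mono (by omega),
    potential_withPrefixes_lt hM hO.head_eq hT hcons fun hiff => hreject (hiff.2 hwbad),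
    fun B hB hXB => ?_⟩
  · simp only [query, bind_val, hq, hw, amend_val]
    rfl
  · have hB := hB.mono hk
    have hB2 := hB.two_le
    have hMB : M.size ≤ B := (hMN.trans (Nat.le_mul_self N)).trans (by omega)
    simp only [query, bind_time, tick_time, hq, hw, pure_time, add_zero]
    exact le_pow_of_le hB2 (add_le_pow hB2 (tick_query_le hB hMB) (add_le_pow hB2
      (hB.incompleteness_time_le hMB) (amend_time_le hB hO.toSized (by omega)))) (by norm_num)

theorem stops_of_incompleteness (hT : AnswersMembership T H) (hE : E.head? = some [])
    (hM : IsConjecture T S E M σ) (hMN : M.size ≤ N) (hq : T.equiv k M.size M.toDFA = none)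
    (hrep : IsRepresentation H M.toDFA.accepts) (hw : (incompleteness M).val = none) :
    Stops H k N X 290 (query T (tableOf T S E) M) := by
  refine ⟨M, ?_, hM.accepts_eq hE hT hrep hw, hMN, fun B hB hXB => ?_⟩
  · simp only [query, bind_val, hq, hw]
    rfl
  · have hB2 := hB.two_le
    have hMB : M.size ≤ B := (hMN.trans (Nat.le_mul_self N)).trans (by omega)
    simp only [query, bind_time, tick_time, hq, hw, pure_time, add_zero]
    exact le_pow_of_le hB2 (add_le_pow hB2 (tick_query_le hB hMB)
      (hB.incompleteness_time_le hMB)) (by norm_num)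

theorem stops_or_progresses_query (hT : MinimalAdequate H T) (hκ : IsTargetArity H κ)
    (hk : k ≤ κ) (hO : Admissible S E X) (hcons : Consistent T S E)
    (hM : IsConjecture T S E M σ) (hMN : M.size ≤ N) :
    Stops H κ N X 290 (query T (tableOf T S E) M) ∨
      Progresses T κ N (potential T κ N S E) X 290 (query T (tableOf T S E) M) := by
  rcases hq : T.equiv k M.size M.toDFA with _ | ⟨c, w⟩
  · have hrep := (hT.equiv_none_iff κ hκ k M.size M.toDFA hk).1 hq
    obtain rfl : k = κ :=
      hk.antisymm (hκ.le_of_isRepresentation ⟨_, inferInstance, M.toDFA, rfl⟩ hrep)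
    rcases hw : (incompleteness M).val with _ | w
    · exact .inl (stops_of_incompleteness hT.member_iff hO.head_eq hM hMN hq hrep hw)
    · exact .inr (progresses_of_incompleteness hT.member_iff hk hO hcons hM
        hMN hq hrep.1 hw)
  · obtain ⟨hcex, hc, -⟩ := hT.equiv_some κ hκ k M.size M.toDFA hk c w hq
    rcases le_or_gt c k with hck | hck
    · exact .inr (progresses_of_counterexample hT.member_iff hk hO hcons hM hMN hq hcex hck)
    · exact .inr (progresses_of_larger_counterexample hO hMN hq hck hc)

end Query

theorem stops_or_progresses (hT : MinimalAdequate H T) (hκ : IsTargetArity H κ)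
    (hN : RowsBounded T κ N) (hk : k ≤ κ) (hO : Admissible S E X) :
    Stops H κ N X 400 (iteration T (tableOf T S E)) ∨
      Progresses T κ N (potential T κ N S E) X 400 (iteration T (tableOf T S E)) := by
  rcases hcons : (inconsistency (tableOf T S E)).val with _ | v
  · rcases hcl : (unclosed (tableOf T S E)).val with _ | v
    · have hval := iteration_val_eq_query (T := T) hcons hcl
      obtain ⟨σ, hσ⟩ := exists_isConjecture hO.nil_mem (closed_of_unclosed hcl)
      have hsize := hσ.size_le.trans (hN hk S E)
      rcases stops_or_progresses_query hT hκ hk hO (consistent_of_inconsistency hcons) hσ hsize with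
        ⟨M, hdone, hM, hMN, htime⟩ | ⟨c, S', E', l, hnext, hc, hO', hφ, htime⟩
      · exact .inl ⟨M, hval.trans hdone, hM, hMN,
          htime.iteration_of_query hO hk hcons hcl (by omega)⟩
      · exact .inr ⟨c, S', E', l, hval.trans hnext, hc, hO', hφ,
          htime.iteration_of_query hO hk hcons hcl (by omega)⟩
    · exact .inr (progresses_of_unclosed hN hk hO hcons hcl)
  · exact .inr (progresses_of_inconsistency hN hk hO hcons)

end Iterations

/-! ### Complete runs -/

section Runs

variable {A : Type} [Fintype A] [DecidableEq A] {T : Teacher A} {H : Hyperproperty A} {κ : ℕ+}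
  {N : ℕ}

theorem exists_runs (hT : MinimalAdequate H T) (hκ : IsTargetArity H κ) (hN : RowsBounded T κ N)
    (n : ℕ) {k : ℕ+} (hk : k ≤ κ) {S E : List (Word A k)} {X : ℕ} (hO : Admissible S E X)
    (hn : potential T κ N S E ≤ n) :
    ∃ (M : Conjecture A κ) (t m : ℕ), Runs T M (tableOf T S E) t m ∧
      M.toDFA.accepts = badWords H κ ∧ M.size ≤ N ∧
        ∀ B, Dominates A κ B → X + (n + 1) * (m + N * N + 1) ≤ B → t ≤ (n + 1) * B ^ 400 := by
  induction n generalizing k S E X with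
  | zero =>
    rcases stops_or_progresses hT hκ hN hk hO with
      ⟨M, hdone, hM, hMN, htime⟩ | ⟨c, S', E', l, -, -, -, hφ, -⟩
    · refine ⟨M, _, 0, .done _ hdone, hM, hMN, fun B hB hXB => ?_⟩
      rw [zero_add, one_mul]
      exact htime B hB (by omega)
    · omega
  | succ n ih =>
    rcases stops_or_progresses hT hκ hN hk hO with
      ⟨M, hdone, hM, hMN, htime⟩ | ⟨c, S', E', l, hnext, hc, hO', hφ, htime⟩
    · refine ⟨M, _, 0, .done _ hdone, hM, hMN, fun B hB hXB => ?_⟩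
      have := Nat.le_mul_of_pos_left (0 + N * N + 1) (show 0 < n + 1 + 1 by omega)
      exact (htime B hB (by omega)).trans (Nat.le_mul_of_pos_left _ (by omega))
    · obtain ⟨M, t, m, hruns, hM, hMN, ht⟩ := ih hc hO' (by omega)
      refine ⟨M, _, _, .next _ _ l t m hnext hruns, hM, hMN, fun B hB hXB => ?_⟩
      have hbudget : X + (l + N * N + 1) + (n + 1) * (m + N * N + 1) ≤ B := by
        have hlater : (n + 1) * (m + N * N + 1) ≤ (n + 1) * (max l m + N * N + 1) :=
          Nat.mul_le_mul_left _ (by omega)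
        rw [add_mul (n + 1) 1, one_mul] at hXB
        omega
      have hfirst := htime B hB (by omega)
      have hlater := ht B hB (by omega)
      rw [add_mul (n + 1) 1, one_mul]
      omega

theorem two_pow_le_add_one_pow (κ : ℕ+) : 2 ^ (κ : ℕ) ≤ ((κ : ℕ) + 1) ^ (κ : ℕ) :=
  Nat.pow_le_pow_left (Nat.succ_le_succ κ.pos) _

theorem two_le_add_one_pow (κ : ℕ+) : 2 ≤ ((κ : ℕ) + 1) ^ (κ : ℕ) :=
  (Nat.le_self_pow κ.ne_zero 2).trans (two_pow_le_add_one_pow κ)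

theorem le_add_one_pow (κ : ℕ+) : (κ : ℕ) ≤ ((κ : ℕ) + 1) ^ (κ : ℕ) :=
  Nat.lt_two_pow_self.le.trans (two_pow_le_add_one_pow κ)

omit [DecidableEq A] in
theorem dominates_base {z : ℕ} (hz : 1 ≤ z) :
    Dominates A κ (z ^ 3 * (((κ : ℕ) + 1) ^ (κ : ℕ)) ^ (Fintype.card A + 7)) := by
  have hκ := le_add_one_pow κ
  have h2 := two_le_add_one_pow κ
  have h2κ := two_pow_le_add_one_pow κ
  generalize hP : ((κ : ℕ) + 1) ^ (κ : ℕ) = P at hκ h2 h2κ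
  have hle {j x : ℕ} (hx : x ≤ P ^ j) (hj : j ≤ Fintype.card A + 7) :
      x ≤ z ^ 3 * P ^ (Fintype.card A + 7) :=
    (hx.trans (Nat.pow_le_pow_right (by omega) hj)).trans
      (Nat.le_mul_of_pos_left _ (Nat.pow_pos hz))
  refine ⟨hle (j := 2) (by nlinarith) (by omega), hle (j := 1) (by rwa [pow_one]) (by omega),
    hle (j := Fintype.card A + 1) ?_ (by omega), hle (j := 1) (by rw [pow_one, hP])
      (by omega)⟩
  calc (Fintype.card A + 1) ^ (κ : ℕ) ≤ (2 ^ (Fintype.card A + 1)) ^ (κ : ℕ) :=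
        Nat.pow_le_pow_left Nat.lt_two_pow_self.le _
    _ = (2 ^ (κ : ℕ)) ^ (Fintype.card A + 1) := by rw [← pow_mul, ← pow_mul, mul_comm]
    _ ≤ P ^ (Fintype.card A + 1) := Nat.pow_le_pow_left h2κ _

theorem iterations_le {N k P : ℕ} (hN : 1 ≤ N) (hk : k ≤ P) (hP : 2 ≤ P) :
    2 * (k * (N + 1) + N) + 2 ≤ 6 * (N * P) := by
  have harity : k * (N + 1) ≤ P * (2 * N) := Nat.mul_le_mul hk (by omega)
  have hrows : N * 2 ≤ N * P := Nat.mul_le_mul_left _ hP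
  linarith

theorem iterations_mul_length_le {N m k P : ℕ} (hN : 1 ≤ N) (hk : k ≤ P) (hP : 2 ≤ P) :
    1 + (2 * (k * (N + 1) + N) + 2) * (m + N * N + 1) ≤ (N + m) ^ 3 * P ^ 7 := by
  have hlength : m + N * N + 1 ≤ 2 * (N + m) ^ 2 := by nlinarith
  have hpos : 1 ≤ (N + m) ^ 3 * P := Nat.mul_pos (Nat.pow_pos (by omega)) (by omega)
  calc 1 + (2 * (k * (N + 1) + N) + 2) * (m + N * N + 1)
      ≤ 1 + 6 * ((N + m) * P) * (2 * (N + m) ^ 2) := by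
        gcongr
        exact (iterations_le hN hk hP).trans (by gcongr; omega)
    _ = 1 + 12 * ((N + m) ^ 3 * P) := by ring
    _ ≤ 2 ^ 6 * ((N + m) ^ 3 * P) := by omega
    _ ≤ P ^ 6 * ((N + m) ^ 3 * P) := by gcongr
    _ = (N + m) ^ 3 * P ^ 7 := by ring

omit [Fintype A] [DecidableEq A] in
theorem admissible_initial : Admissible (A := A) (k := 1) [[]] [[]] 1 :=
  ⟨⟨le_rfl, le_rfl, List.forall_mem_singleton.2 zero_le_one,
    List.forall_mem_singleton.2 zero_le_one⟩, List.mem_singleton_self _, rfl⟩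

theorem exists_learns (hT : MinimalAdequate H T) (hκ : IsTargetArity H κ)
    (hN : RowsBounded T κ N) :
    ∃ (M : Conjecture A κ) (t m : ℕ), Learns T M t m ∧ M.toDFA.accepts = badWords H κ ∧
      M.size ≤ N ∧
        t ≤ (N + m) ^ 1206 * (((κ : ℕ) + 1) ^ (κ : ℕ)) ^ ((Fintype.card A + 7) * 402) := by
  obtain ⟨M, t, m, hruns, hM, hMN, ht⟩ :=
    exists_runs hT hκ hN _ one_le admissible_initial potential_le
  refine ⟨M, _, m, ⟨t, rfl, by rwa [fill_val]⟩, hM, hMN, ?_⟩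
  have hN : 1 ≤ N := (Nat.le_add_left 1 M.last).trans hMN
  have hκP := le_add_one_pow κ
  have hP := two_le_add_one_pow κ
  have hB := dominates_base (A := A) (κ := κ) (show 1 ≤ N + m by omega)
  generalize ((κ : ℕ) + 1) ^ (κ : ℕ) = P at hκP hP hB ⊢
  set B := (N + m) ^ 3 * P ^ (Fintype.card A + 7) with hBdef
  have hbudget : 1 + (2 * (κ * (N + 1) + N) + 2) * (m + N * N + 1) ≤ B :=
    (iterations_mul_length_le hN hκP hP).trans
      (Nat.mul_le_mul_left _ (Nat.pow_le_pow_right (by omega) (by omega)))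
  have hiterations : 2 * (κ * (N + 1) + N) + 2 ≤ B :=
    (Nat.le_mul_of_pos_right _ (by omega : 0 < m + N * N + 1)).trans (by omega)
  have hfill : (fill T (k := 1) [[]] [[]]).time ≤ B ^ (1 + 400) :=
    le_pow_of_le hB.two_le
      (fill_time_le (hB.mono one_le) (admissible_initial.toSized.mono (by omega))) (by norm_num)
  have hruntime : t ≤ B ^ (1 + 400) := (ht B hB hbudget).trans (mul_le_pow (by simpa) le_rfl)
  calc (fill T (k := 1) [[]] [[]]).time + t ≤ B ^ (1 + 400) * 2 := by omega
    _ ≤ B ^ (1 + 400) * B := Nat.mul_le_mul_left _ hB.two_le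
    _ = (N + m) ^ 1206 * P ^ ((Fintype.card A + 7) * 402) := by
      rw [← pow_succ, hBdef, mul_pow, ← pow_mul, ← pow_mul]

end Runs

theorem exists_minimal_dfa {α : Type} {L : Language α} (hL : L.IsRegular) :
    ∃ (N : ℕ) (D : DFA α (Fin N)), D.accepts = L ∧
      ∀ (n : ℕ) (M : DFA α (Fin n)), M.accepts = L → N ≤ n := by
  classical
  have hex : ∃ (N : ℕ) (D : DFA α (Fin N)), D.accepts = L := by
    obtain ⟨σ, _, D, hD⟩ := hL
    exact ⟨_, DFA.reindex (Fintype.equivFin σ) D, by rw [DFA.accepts_reindex, hD]⟩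
  obtain ⟨D, hD⟩ := Nat.find_spec hex
  exact ⟨_, D, hD, fun n M hM => Nat.find_min' hex ⟨M, hM⟩⟩

end HyperLearn

theorem mainTheorem6 (A : Type) [Fintype A] [DecidableEq A] :
    ∃ C : ℕ, ∀ (S : Hyperproperty A) (k₀ : ℕ+), IsKSafety S k₀ → IsRegularHyper S →
      ∀ T : Teacher A, MinimalAdequate S T →
        ∃ (k : ℕ+) (M : Conjecture A k) (t m : ℕ),
          Learns T M t m ∧ IsMinimalBPA S M.toDFA ∧ k ≤ k₀ ∧
            t ≤ C * (M.size + m) ^ C * ((k : ℕ) + 1) ^ (C * (k : ℕ)) := by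
  refine ⟨(Fintype.card A + 7) * 402, fun S k₀ hsafe hreg T hT => ?_⟩
  obtain ⟨κ, hκ⟩ := hreg.exists_isTargetArity
  obtain ⟨L, hL, hrep⟩ := hκ.1
  obtain ⟨N, D, hD, hmin⟩ := exists_minimal_dfa (hrep.isRegular_badWords hL κ)
  have hrows : RowsBounded T κ N := fun k hk _ _ =>
    (rowCount_le_card_states hT.member_iff hk hD).trans_eq (Fintype.card_fin N)
  obtain ⟨M, t, m, hlearn, hM, hMN, ht⟩ := exists_learns hT hκ hrows
  obtain rfl : M.size = N := hMN.antisymm (hmin _ M.toDFA hM)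
  have hBPA : IsMinimalBPA S M.toDFA :=
    ⟨⟨hM ▸ hrep.badWords, hM ▸ isTight_badWords hrep.empty_mem, hM ▸ isPermComplete_badWords⟩,
      hκ.2, fun _ M' hM' =>
        hmin _ M' (eq_badWords_of_isTight hM'.representation hM'.tight hM'.permComplete)⟩
  refine ⟨κ, M, t, m, hlearn, hBPA, hκ.le_of_isRepresentation (hrep.isRegular_badWords hL k₀)
    (hsafe.isRepresentation_badWords hrep.empty_mem), ht.trans (Nat.mul_le_mul ?_ ?_)⟩
  · have hpos : 1 ≤ M.size + m := Nat.le_add_right_of_le (Nat.le_add_left 1 M.last)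
    refine le_trans (pow_le_pow_right₀ hpos ?_) (Nat.le_mul_of_pos_left _ (by omega))
    omega
  · rw [← pow_mul, mul_comm]
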